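/- **Definitions.** A permutation of length $n\ge 1$ is a bijection $\sigma:[n]\to[n]$, and we write $|\sigma|=n$. For permutations $\tau$ of length $k$ and $\sigma$ of length $n$, let $\Lambda(\tau,\sigma)$ be the number of tuples $x_1<\dots<x_k$ in $[n]$ such that, for all $i,j$, $\sigma(x_i)<\sigma(x_j)$ if and only if $\tau(i)<\tau(j)$, and put $t(\tau,\sigma)=\binom nk^{-1}\Lambda(\tau,\sigma)$ if $k\le n$ and $t(\tau,\sigma)=0$ if $k>n$. A *cdf* is a non-decreasing left-continuous function $F:[0,1]\to[0,1]$ with $F(0)=0$; $dF$ denotes the Borel measure on $[0,1]$ of total mass $1$ with $dF([a,b))=F(b)-F(a)$ for $0\le a<b\le 1$, and $\int_a^b dF=dF([a,b])$. A *limit permutation* is a Lebesgue measurable function $Z:[0,1]^2\to[0,1]$ such that, for every $x$, $Z(x,\cdot)$ is a cdf, continuous at $0$, with $Z(x,1)=1$, and, for every $y$, $\int_0^1 Z(x,y)\,dx=y$. Let $[0,1]^m_<=\{(y_1,\dots,y_m)\in[0,1]^m: y_1<\dots<y_m\}$. For a permutation $\tau$ of length $m$ and a limit permutation $Z$ let $$t(\tau,Z)=m!\int_{[0,1]^m_<}\Big(\int_{[0,1]^m_<}dZ(x_{\tau^{-1}(1)},\cdot)\cdots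 dZ(x_{\tau^{-1}(m)},\cdot)\Big)dx_1\cdots dx_m ,$$ where the inner integral is the mass that the product measure gives to $[0,1]^m_<$. A sequence $(\sigma_n)_{n\in\mathbb N}$ of permutations (of arbitrary lengths) *converges to* $Z$ (and $Z$ is a *limit* of the sequence) if $\lim_{n\to\infty}t(\tau,\sigma_n)=t(\tau,Z)$ for every permutation $\tau$. For a permutation $\sigma$ of length $n$, the step function $Z_\sigma:[0,1]^2\to[0,1]$ is given by $Z_\sigma(x,0)=0$; $Z_\sigma(0,y)=\lceil ny\rceil/n$ for $y>0$; and, for $x,y>0$, $Z_\sigma(x,y)=1$ if $\sigma(\lceil nx\rceil)<\lceil ny\rceil$ and $Z_\sigma(x,y)=0$ otherwise. For functions $Z_1,Z_2:[0,1]^2\to[0,1]$ such that $Z_i(x,\cdot)$ is a cdf for every $x$, the *rectangular distance* is $$d_\square(Z_1,Z_2)=\sup_{\substack{x_1<x_2\in[0,1]\\ \alpha_1<\alpha_2\in[0,1]}}\Big|\int_{x_1}^{x_2}\int_{\alpha_1}^{\alpha_2}dZ_1(x,\cdot)\,dx-\int_{x_1}^{x_2}\int_{\alpha_1}^{\alpha_2}dZ_2(x,\cdot)\,dx\Big|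 .$$ **Theorem 5.2.** Let $Z_1,Z_2$ be limit permutations. (i) $d_\square(Z_1,Z_2)=0$ if and only if $Z_1=Z_2$ almost everywhere on $[0,1]^2$ with respect to Lebesgue measure. (ii) A permutation sequence $(\sigma_n)_{n\in\mathbb N}$ converges to a limit permutation $Z$ if and only if $\lim_{n\to\infty}d_\square(Z_{\sigma_n},Z)=0$. In particular, if $(\sigma_n)_{n\in\mathbb N}$ is a permutation sequence converging to $Z_1$, then $Z_2$ is a limit of $(\sigma_n)$ if and only if $Z_1=Z_2$ almost everywhere. -/

import Mathlib

open MeasureTheory Set Filter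
open scoped unitInterval Topology

noncomputable section

namespace PermLimit

/-! ### Finite permutations and subpermutation densities -/

/-- Finite permutations: a length `n ≥ 1` together with a permutation of `n` points.
The points `1, …, n` are represented by `0, …, n - 1 : Fin n`. -/
abbrev FinPerm : Type := Σ n : ℕ+, Equiv.Perm (Fin n)

/-- The length of a permutation. -/
def FinPerm.length (π : FinPerm) : ℕ := π.1

/-- The number of occurrences of `τ` in `π`: the number of strictly increasing tuples
`x₁ < ⋯ < x_k` of positions with `π (x i) < π (x j)` if and only if `τ i < τ j`. -/
def occurrences (τ π : FinPerm) : ℕ :=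
  Set.ncard {x : Fin τ.1 → Fin π.1 |
    StrictMono x ∧ ∀ i j, π.2 (x i) < π.2 (x j) ↔ τ.2 i < τ.2 j}

/-- The density of `τ` as a subpermutation of `π`. -/
def density (τ π : FinPerm) : ℝ :=
  if τ.length ≤ π.length then (occurrences τ π : ℝ) / (π.length.choose τ.length : ℝ) else 0

/-! ### Cumulative distribution functions on the unit interval -/

/-- A cdf: a non-decreasing left-continuous function `F : [0,1] → [0,1]` with `F 0 = 0`. -/
structure IsCdf (F : I → I) : Prop where
  mono : Monotone F
  left_cont : ∀ y, ContinuousWithinAt F (Iic y) y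
  map_zero : F 0 = 0

/-- Extension of `F : [0,1] → [0,1]` to the real line, by `0` to the left of `0` and
by `1` to the right of `1`. -/
def extend (F : I → I) (y : ℝ) : ℝ :=
  if h : y ∈ Icc (0 : ℝ) 1 then (F ⟨y, h⟩ : ℝ) else if y < 0 then 0 else 1

theorem extend_mono {F : I → I} (hF : Monotone F) : Monotone (extend F) := by
  intro a b hab
  by_cases ha : a ∈ Icc (0 : ℝ) 1 <;> by_cases hb : b ∈ Icc (0 : ℝ) 1
  · simp only [extend, dif_pos ha, dif_pos hb]
    exact hF (Subtype.mk_le_mk.2 hab)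
  · have : ¬ b < 0 := not_lt.2 (ha.1.trans hab)
    simpa only [extend, dif_pos ha, dif_neg hb, if_neg this] using (F ⟨a, ha⟩).2.2
  · have : a < 0 := by
      by_contra h
      exact ha ⟨not_lt.1 h, hab.trans hb.2⟩
    simpa only [extend, dif_neg ha, dif_pos hb, if_pos this] using (F ⟨b, hb⟩).2.1
  · simp only [extend, dif_neg ha, dif_neg hb]
    split_ifs with h1 h2 h3
    · exact le_rfl
    · exact zero_le_one
    · exact absurd (hab.trans_lt h3) h1
    · exact le_rfl

open Classical in
/-- The Lebesgue-Stieltjes probability measure `dF` on `[0,1]` of a cdf `F`, that is, the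
measure of total mass one with `dF [a, b) = F b - F a` for `a ≤ b` (see `cdfMeasure_univ` and
`cdfMeasure_Ico`). If `F 1 < 1`, the missing mass sits at the point `1`.
Mathlib's Stieltjes measures belong to right-continuous functions, hence the passage to right
limits inside `Monotone.stieltjesFunction`. The value is `0` if `F` is not monotone. -/
def cdfMeasure (F : I → I) : Measure I :=
  if h : Monotone F then
    (extend_mono h).stieltjesFunction.measure.comap (Subtype.val : I → ℝ)
  else 0

theorem leftLim_extend {F : I → I} (hF : IsCdf F) (y : I) :
    Function.leftLim ((extend_mono hF.mono).stieltjesFunction) y = F y := by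
  have hE : ∀ z : ℝ, z ≤ 1 → extend F z = F (projIcc 0 1 zero_le_one z) := by
    intro z hz
    unfold extend
    split_ifs with h1 h2
    · rw [projIcc_of_mem _ h1]
    · rw [projIcc_of_le_left _ h2.le]
      exact (congrArg Subtype.val hF.map_zero).symm
    · exact absurd ⟨not_lt.1 h2, hz⟩ h1
  have hy : extend F y = F y := by rw [hE _ y.2.2, projIcc_val]
  have hc : ContinuousWithinAt (extend F) (Iio (y : ℝ)) y := by
    have h1 : ContinuousWithinAt (fun z : ℝ => (F (projIcc 0 1 zero_le_one z) : ℝ))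
        (Iic (y : ℝ)) y := by
      refine continuous_subtype_val.continuousAt.comp_continuousWithinAt ?_
      refine ContinuousWithinAt.comp (t := Iic y) ?_ continuous_projIcc.continuousWithinAt ?_
      · rw [projIcc_val]; exact hF.left_cont y
      · intro z hz
        exact (monotone_projIcc zero_le_one hz).trans_eq (projIcc_val _ y)
    refine (h1.congr (fun z hz => hE z (le_trans hz y.2.2)) (hE _ y.2.2)).mono Iio_subset_Iic_self
  change Function.leftLim (Function.rightLim (extend F)) (y : ℝ) = _
  rw [leftLim_rightLim ((extend_mono hF.mono).tendsto_leftLim _),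
    leftLim_eq_of_tendsto hc.tendsto, hy]

theorem cdfMeasure_Ico {F : I → I} (hF : IsCdf F) (a b : I) :
    cdfMeasure F (Ico a b) = ENNReal.ofReal ((F b : ℝ) - F a) := by
  have himg : (Subtype.val : I → ℝ) '' Ico a b = Ico (a : ℝ) b := by
    ext z
    constructor
    · rintro ⟨w, hw, rfl⟩; exact hw
    · intro hz
      exact ⟨⟨z, a.2.1.trans hz.1, hz.2.le.trans b.2.2⟩, hz, rfl⟩
  rw [cdfMeasure, dif_pos hF.mono, unitInterval.measurableEmbedding_coe.comap_apply, himg,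
    StieltjesFunction.measure_Ico, leftLim_extend hF, leftLim_extend hF]

theorem cdfMeasure_univ {F : I → I} (hF : IsCdf F) : cdfMeasure F univ = 1 := by
  have himg : (Subtype.val : I → ℝ) '' univ = Icc ((0 : I) : ℝ) 1 := by
    rw [image_univ, Subtype.range_coe]; rfl
  have h1 : (extend_mono hF.mono).stieltjesFunction 1 = 1 := by
    rw [Monotone.stieltjesFunction_eq]
    have hc : ContinuousWithinAt (fun _ : ℝ => (1 : ℝ)) (Ioi 1) 1 := continuousWithinAt_const
    refine rightLim_eq_of_tendsto (Tendsto.congr' ?_ hc)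
    filter_upwards [self_mem_nhdsWithin] with z hz
    have hz' : (1 : ℝ) < z := hz
    rw [extend, dif_neg (fun h => absurd h.2 (not_le.2 hz')),
      if_neg (by linarith)]
  rw [cdfMeasure, dif_pos hF.mono, unitInterval.measurableEmbedding_coe.comap_apply, himg,
    StieltjesFunction.measure_Icc, leftLim_extend hF, h1, hF.map_zero]
  simp

/-! ### Limit permutations -/

/-- A limit permutation: a Lebesgue measurable function `Z : [0,1]² → [0,1]` such that every
`Z x ·` is a cdf that is continuous at `0` and takes the value `1` at `1`, and such that
`∫ Z x y dx = y` for every `y`. -/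
structure LimitPermutation where
  toFun : I → I → I
  measurable : NullMeasurable (Function.uncurry toFun) (volume : Measure (I × I))
  isCdf : ∀ x, IsCdf (toFun x)
  continuousAt_zero : ∀ x, ContinuousAt (toFun x) 0
  map_one : ∀ x, toFun x 1 = 1
  integral_eq : ∀ y, ∫ x, (toFun x y : ℝ) = y

/-- The core function of `Z`: the mass that the product of the measures
`dZ (x (τ⁻¹ 1)) ·, …, dZ (x (τ⁻¹ m)) ·` gives to the simplex `y₁ < ⋯ < y_m`. -/
def core (τ : FinPerm) (Z : I → I → I) (x : Fin τ.1 → I) : ℝ :=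
  (Measure.pi fun i => cdfMeasure (Z (x (τ.2⁻¹ i)))).real {y | StrictMono y}

/-- The subpermutation density of `τ` in `Z`: `m!` times the integral of the core function over
the simplex `x₁ < ⋯ < x_m`. -/
def limitDensity (τ : FinPerm) (Z : I → I → I) : ℝ :=
  (τ.length.factorial : ℝ) * ∫ x in {x : Fin τ.1 → I | StrictMono x}, core τ Z x

/-- A sequence of permutations converges to `Z` if the density of every permutation `τ`
converges to the density of `τ` in `Z`. -/
def ConvergesTo (π : ℕ → FinPerm) (Z : LimitPermutation) : Prop :=
  ∀ τ : FinPerm, Tendsto (fun n => density τ (π n)) atTop (𝓝 (limitDensity τ Z.toFun))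

/-! ### Step functions and the rectangular distance -/

/-- The index `⌈n x⌉ ∈ {1, …, n}` of the cell of `[0,1]` containing `x ∈ (0,1]`, lowered by one
because `Fin n` starts at `0`. -/
def cell (n : ℕ+) (x : I) : Fin n :=
  ⟨⌈(n : ℝ) * (x : ℝ)⌉₊ - 1, by
    have h : ⌈(n : ℝ) * (x : ℝ)⌉₊ ≤ (n : ℕ) :=
      Nat.ceil_le.2 (mul_le_of_le_one_right (Nat.cast_nonneg _) x.2.2)
    have := n.pos
    omega⟩

/-- The step function `Z_π` of a permutation `π` of length `n`: it is `0` for `y = 0`, it is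
`⌈n y⌉ / n` for `x = 0 < y`, and for `x, y > 0` it is `1` if `π ⌈n x⌉ < ⌈n y⌉` and `0`
otherwise. -/
def stepFunction (π : FinPerm) (x y : I) : I :=
  if y = 0 then 0
  else if x = 0 then
    ⟨(⌈(π.length : ℝ) * (y : ℝ)⌉₊ : ℝ) / (π.length : ℝ),
      div_nonneg (Nat.cast_nonneg _) (Nat.cast_nonneg _),
      div_le_one_of_le₀
        (Nat.cast_le.2 (Nat.ceil_le.2 (mul_le_of_le_one_right (Nat.cast_nonneg _) y.2.2)))
        (Nat.cast_nonneg _)⟩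
  else if π.2 (cell π.1 x) < cell π.1 y then 1 else 0

/-- The rectangular distance: the supremum of
`|∫_{x₁}^{x₂} ∫_{α₁}^{α₂} dZ₁(x,·) dx - ∫_{x₁}^{x₂} ∫_{α₁}^{α₂} dZ₂(x,·) dx|` over `x₁ < x₂` and
`α₁ < α₂` in `[0,1]`, where `∫_a^b` is the integral over the closed interval `[a, b]`. -/
def rectDist (Z₁ Z₂ : I → I → I) : ℝ :=
  sSup {d : ℝ | ∃ x₁ x₂ α₁ α₂ : I, x₁ < x₂ ∧ α₁ < α₂ ∧
    d = |(∫ x in Icc x₁ x₂, (cdfMeasure (Z₁ x)).real (Icc α₁ α₂)) -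
      ∫ x in Icc x₁ x₂, (cdfMeasure (Z₂ x)).real (Icc α₁ α₂)|}

/-- `Z₁ = Z₂` almost everywhere on `[0,1]²`. -/
def AlmostEqual (Z₁ Z₂ : LimitPermutation) : Prop :=
  (volume : Measure (I × I)) {p | Z₁.toFun p.1 p.2 ≠ Z₂.toFun p.1 p.2} = 0

end PermLimit

end

noncomputable section

namespace PermLimit

/-! ### Product measures and order patterns -/

/-! Both kinds of object become probability measures on the unit square. A limit permutation `Z`
gives `Z.measure`, with uniform first marginal and conditional laws `dZ(x, ·)`; the condition `∫
Z(x, y) dx = y` makes the second marginal uniform too. A permutation of length `n` gives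
`stepMeasure`, carried by its rescaled graph, with marginals uniform up to `1 / n`. The rectangular
distance is then the largest discrepancy on closed rectangles. The density of a pattern of length
`m` is `m!` times its `patternMass`, exactly for `Z` and up to a factor tending to `1` for
permutations whose lengths tend to infinity (`limitDensity_eq`, `tendsto_density_iff`).

Distance zero means equal masses of rectangles, hence equal measures, and almost everywhere
uniqueness of conditional laws recovers `Z` (`almostEqual_of_measure_rect_eq`).

Small distance forces close densities: replace the sample points one by one. With the others fixed,
the admissible positions of one point form an open rectangle, so each replacement costs at most the
distance (`abs_patternMass_sub_le`).

Conversely, let all densities converge. Since the marginals are nearly uniform, the moment `∫ x ^ a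
* y ^ b` is nearly the probability that one point exceeds `a` others in the first coordinate and `b`
further ones in the second. This event depends only on relative orders, so moments converge
(`tendsto_moment`). Stone-Weierstrass gives weak convergence, and compactness of the space of
rectangles makes the convergence of their masses uniform (`tendstoUniformly_rect`).

Either form of convergence forces the lengths to infinity: every length has a pattern of nonzero
density in `Z`, and the distance from a permutation of length `n` to `Z` is at least `1 / n`. -/

theorem measurableSet_strictMono {α ι : Type*} [MeasurableSpace α] [Preorder ι] [Countable ι]
    {f : α → ι → I} (hf : ∀ i, Measurable fun a => f a i) : MeasurableSet {a | StrictMono (f a)} := by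
  simp only [StrictMono, ofPred_forall]
  exact MeasurableSet.iInter fun i => MeasurableSet.iInter fun j => MeasurableSet.iInter fun _ =>
    measurableSet_lt (hf i) (hf j)

/-- The product measure of a set as an integral over all coordinates but one. -/
theorem pi_apply_eq_lintegral_others {α : Type*} [MeasurableSpace α] {N : ℕ}
    (ν : Fin (N + 1) → Measure α) [∀ i, IsProbabilityMeasure (ν i)] (i : Fin (N + 1))
    {S : Set (Fin (N + 1) → α)} (hS : MeasurableSet S) :
    Measure.pi ν S = ∫⁻ w, ν i {p | i.insertNth p w ∈ S}
      ∂(Measure.pi fun j => ν (i.succAbove j)) := by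
  have h := (measurePreserving_piFinSuccAbove ν i).symm
  rw [← h.measure_preimage hS.nullMeasurableSet, Measure.prod_apply_symm (h.measurable hS)]
  rfl

/-- The product measure of a set as an integral over one coordinate. -/
theorem pi_apply_eq_lintegral_one {α : Type*} [MeasurableSpace α] {N : ℕ}
    (ν : Fin (N + 1) → Measure α) [∀ i, IsProbabilityMeasure (ν i)] (i : Fin (N + 1))
    {S : Set (Fin (N + 1) → α)} (hS : MeasurableSet S) :
    Measure.pi ν S = ∫⁻ p, (Measure.pi fun j => ν (i.succAbove j)) {w | i.insertNth p w ∈ S}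
      ∂ν i := by
  have h := (measurePreserving_piFinSuccAbove ν i).symm
  rw [← h.measure_preimage hS.nullMeasurableSet, Measure.prod_apply (h.measurable hS)]
  rfl

/-- The event that `a` sorts the first coordinates and `b` the second coordinates of the points
of a tuple. -/
def sortedBy {m : ℕ} (a b : Equiv.Perm (Fin m)) : Set (Fin m → I × I) :=
  {z | StrictMono (fun i => (z (a i)).1) ∧ StrictMono (fun i => (z (b i)).2)}

/-- The probability that `m` independent points with law `ν`, listed by increasing first
coordinate, form the pattern `τ`, up to the factor `m!`. -/
def patternMass {m : ℕ} (τ : Equiv.Perm (Fin m)) (ν : Measure (I × I)) : ℝ :=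
  (Measure.pi fun _ : Fin m => ν).real (sortedBy 1 τ⁻¹)

theorem measurableSet_sortedBy {m : ℕ} (a b : Equiv.Perm (Fin m)) :
    MeasurableSet (sortedBy a b) :=
  (measurableSet_strictMono fun i => (measurable_pi_apply (a i)).fst).inter
    (measurableSet_strictMono fun i => (measurable_pi_apply (b i)).snd)

/-- The points are independent with the same law, so relabelling them by `a` is harmless. The point
with `i`-th smallest first coordinate is `z (a i)`, whose rank in the second coordinate is `b⁻¹ (a
i)`. -/
theorem measureReal_sortedBy {m : ℕ} (a b : Equiv.Perm (Fin m)) (ν : Measure (I × I))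
    [IsProbabilityMeasure ν] :
    (Measure.pi fun _ : Fin m => ν).real (sortedBy a b) = patternMass (b⁻¹ * a) ν := by
  have h := measurePreserving_piCongrLeft (fun _ : Fin m => ν) a.symm
  have h2 := h.measureReal_preimage (s := sortedBy 1 (b⁻¹ * a)⁻¹)
    (measurableSet_sortedBy _ _).nullMeasurableSet
  rw [patternMass, ← h2]
  congr 1
  have key : ∀ (z : Fin m → I × I) (i : Fin m),
      MeasurableEquiv.piCongrLeft (fun _ => I × I) a.symm z i = z (a i) := fun z i => by
    rw [MeasurableEquiv.coe_piCongrLeft]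
    simpa using Equiv.piCongrLeft_apply (P := fun _ : Fin m => I × I) a.symm z i
  ext z
  simp only [sortedBy, mem_preimage, mem_ofPred_eq, key]
  simp

theorem sortedBy_disjoint {m : ℕ} {a b a' b' : Equiv.Perm (Fin m)} {z : Fin m → I × I}
    (h : z ∈ sortedBy a b) (h' : z ∈ sortedBy a' b') : a = a' ∧ b = b' := by
  have key : ∀ (f : Fin m → I) (c c' : Equiv.Perm (Fin m)), StrictMono (fun i => f (c i)) →
      StrictMono (fun i => f (c' i)) → c = c' := by
    intro f c c' h h'
    have h1 : f ∘ c = f ∘ c' := Tuple.unique_monotone h.monotone h'.monotone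
    have hf : Function.Injective f := by
      intro x y hxy
      have := h.injective (a₁ := c.symm x) (a₂ := c.symm y) (by simpa using hxy)
      simpa using this
    ext i
    exact congrArg _ (hf (congrFun h1 i))
  exact ⟨key (fun i => (z i).1) _ _ h.1 h'.1, key (fun i => (z i).2) _ _ h.2 h'.2⟩

theorem exists_strictMono_comp_perm {m : ℕ} {f : Fin m → I} (hf : Function.Injective f) :
    ∃ c : Equiv.Perm (Fin m), StrictMono (fun i => f (c i)) :=
  ⟨Tuple.sort f, (Tuple.monotone_sort f).strictMono_of_injective
    (hf.comp (Tuple.sort f).injective)⟩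

/-! ### Measures with almost uniform marginals -/

/-- A probability measure on `[0,1]` that gives an interval at most its length plus `ε`. -/
structure NearUniform (ε : ℝ) (ρ : Measure I) : Prop where
  isProb : IsProbabilityMeasure ρ
  Icc_le : ∀ a b : I, a ≤ b → ρ.real (Icc a b) ≤ b - a + ε

/-- A measure on the unit square whose two marginals are almost uniform. -/
structure NearPermuton (ε : ℝ) (ν : Measure (I × I)) : Prop where
  fst : NearUniform ε (ν.map Prod.fst)
  snd : NearUniform ε (ν.map Prod.snd)

theorem nearUniform_volume : NearUniform 0 (volume : Measure I) where
  isProb := inferInstance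
  Icc_le a b hab := by
    rw [Measure.real, unitInterval.volume_Icc, ENNReal.toReal_ofReal, add_zero]
    exact sub_nonneg.2 hab

theorem NearUniform.singleton_le {ε : ℝ} {ρ : Measure I} (h : NearUniform ε ρ) (a : I) :
    ρ.real {a} ≤ ε := by
  simpa using h.Icc_le a a le_rfl

theorem NearUniform.nonneg {ε : ℝ} {ρ : Measure I} (h : NearUniform ε ρ) : 0 ≤ ε :=
  measureReal_nonneg.trans (h.singleton_le 0)

theorem NearUniform.abs_Iio_sub_le {ε : ℝ} {ρ : Measure I} (h : NearUniform ε ρ) (a : I) :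
    |ρ.real (Iio a) - a| ≤ ε := by
  have := h.isProb
  have h1 : ρ.real (Iio a) ≤ a + ε := by
    have h2 := h.Icc_le 0 a unitInterval.nonneg'
    have h3 : ρ.real (Iio a) ≤ ρ.real (Icc 0 a) :=
      measureReal_mono fun x hx => ⟨unitInterval.nonneg', le_of_lt hx⟩
    simp only [Icc.coe_zero, sub_zero] at h2
    exact h3.trans h2
  -- The total mass is one, so the upper bound on the complement is the lower bound on `Iio a`.
  have h4 : 1 - ρ.real (Iio a) ≤ 1 - a + ε := by
    have h2 := h.Icc_le a 1 unitInterval.le_one'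
    rw [← probReal_compl_eq_one_sub measurableSet_Iio]
    refine (measureReal_mono fun x hx => ?_).trans h2
    exact ⟨not_lt.1 hx, unitInterval.le_one'⟩
  rw [abs_le]
  constructor <;> linarith

theorem abs_prod_sub_prod_le {ι : Type*} (s : Finset ι) {f g : ι → ℝ} {δ : ℝ}
    (hf : ∀ i, f i ∈ Icc (0 : ℝ) 1) (hg : ∀ i, g i ∈ Icc (0 : ℝ) 1) (h : ∀ i, |f i - g i| ≤ δ) :
    |∏ i ∈ s, f i - ∏ i ∈ s, g i| ≤ s.card * δ := by
  classical
  induction s using Finset.induction_on with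
  | empty => simp
  | insert a s ha ih =>
    rw [Finset.prod_insert ha, Finset.prod_insert ha, Finset.card_insert_of_notMem ha]
    have h1 : |∏ i ∈ s, g i| ≤ 1 := by
      rw [abs_of_nonneg (Finset.prod_nonneg fun i _ => (hg i).1)]
      exact Finset.prod_le_one (fun i _ => (hg i).1) fun i _ => (hg i).2
    have h2 : |f a| ≤ 1 := by rw [abs_of_nonneg (hf a).1]; exact (hf a).2
    calc |f a * ∏ i ∈ s, f i - g a * ∏ i ∈ s, g i|
        = |f a * (∏ i ∈ s, f i - ∏ i ∈ s, g i) + (f a - g a) * ∏ i ∈ s, g i| := by ring_nf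
      _ ≤ |f a| * |∏ i ∈ s, f i - ∏ i ∈ s, g i| + |f a - g a| * |∏ i ∈ s, g i| := by
        rw [← abs_mul, ← abs_mul]; exact abs_add_le _ _
      _ ≤ 1 * (s.card * δ) + δ * 1 := by
        gcongr
        · exact (abs_nonneg _).trans (h a)
        · exact h a
      _ = _ := by push_cast; ring

/-- Given all points but the `i`-th, a tie means that this point falls into one prescribed fibre of
`f`, whose mass is at most `ε`. -/
theorem measureReal_tie_le {α : Type*} [MeasurableSpace α] {ν : Measure α} [IsProbabilityMeasure ν]
    {f : α → I} (hf : Measurable f) {ε : ℝ} (h : NearUniform ε (ν.map f)) {m : ℕ} {i j : Fin m}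
    (hij : i ≠ j) :
    (Measure.pi fun _ : Fin m => ν).real {z | f (z i) = f (z j)} ≤ ε := by
  obtain _ | N := m
  · exact i.elim0
  obtain ⟨k, rfl⟩ := Fin.exists_succAbove_eq hij.symm
  refine ENNReal.toReal_le_of_le_ofReal h.nonneg ?_
  have hS : MeasurableSet {z : Fin (N + 1) → α | f (z i) = f (z (i.succAbove k))} :=
    measurableSet_eq_fun (hf.comp (measurable_pi_apply _)) (hf.comp (measurable_pi_apply _))
  rw [pi_apply_eq_lintegral_others (fun _ => ν) i hS]
  calc _ ≤ ∫⁻ _, ENNReal.ofReal ε ∂(Measure.pi fun _ : Fin N => ν) := by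
        refine lintegral_mono fun w => ?_
        have h1 := h.singleton_le (f (w k))
        have := h.isProb
        rw [Measure.real, Measure.map_apply hf (measurableSet_singleton _)] at h1
        refine ((ENNReal.le_ofReal_iff_toReal_le (measure_ne_top _ _) h.nonneg).2 h1).trans' ?_
        refine measure_mono fun p hp => ?_
        simpa using hp
    _ = _ := by simp

/-- The tuples in which two of the points share a coordinate. -/
def ties (m : ℕ) : Set (Fin m → I × I) :=
  {z | ¬ (Function.Injective (fun i => (z i).1) ∧ Function.Injective (fun i => (z i).2))}

/-- Union bound over the `m ^ 2` ordered pairs of indices and the two coordinates. -/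
theorem measureReal_ties_le {ν : Measure (I × I)} [IsProbabilityMeasure ν] {ε : ℝ}
    (h : NearPermuton ε ν) (m : ℕ) :
    (Measure.pi fun _ : Fin m => ν).real (ties m) ≤ 2 * m ^ 2 * ε := by
  set P := Measure.pi fun _ : Fin m => ν
  have hsub : ties m ⊆ ⋃ q ∈ (Finset.univ : Finset (Fin m × Fin m)),
      (({z | q.1 ≠ q.2 ∧ (z q.1).1 = (z q.2).1}) ∪ {z | q.1 ≠ q.2 ∧ (z q.1).2 = (z q.2).2}) := by
    intro z hz
    simp only [ties, mem_ofPred_eq, not_and_or, Function.Injective, not_forall] at hz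
    simp only [Finset.mem_univ, iUnion_true, mem_iUnion]
    rcases hz with ⟨i, j, h1, h2⟩ | ⟨i, j, h1, h2⟩
    · exact ⟨(i, j), Or.inl ⟨h2, h1⟩⟩
    · exact ⟨(i, j), Or.inr ⟨h2, h1⟩⟩
  have hε := h.fst.nonneg
  calc P.real (ties m) ≤ _ := measureReal_mono hsub (measure_ne_top _ _)
    _ ≤ _ := measureReal_biUnion_finset_le _ _
    _ ≤ ∑ _q : Fin m × Fin m, (ε + ε) := by
      refine Finset.sum_le_sum fun q _ => (measureReal_union_le _ _).trans (add_le_add ?_ ?_)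
      · by_cases hq : q.1 = q.2
        · simpa [hq] using hε
        · exact (measureReal_mono fun z hz => hz.2).trans (measureReal_tie_le measurable_fst h.fst hq)
      · by_cases hq : q.1 = q.2
        · simpa [hq] using hε
        · exact (measureReal_mono fun z hz => hz.2).trans (measureReal_tie_le measurable_snd h.snd hq)
    _ = _ := by simp; ring

/-- An event that depends only on the relative orders of the coordinates has a probability that
is a sum of pattern probabilities, up to the probability of ties. -/
theorem abs_measureReal_sub_sum_patternMass_le {ν : Measure (I × I)} [IsProbabilityMeasure ν] {ε : ℝ}
    (h : NearPermuton ε ν) {m : ℕ} {E : Set (Fin m → I × I)}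
    {G : Finset (Equiv.Perm (Fin m) × Equiv.Perm (Fin m))}
    (hG : ∀ a b, ∀ z ∈ sortedBy a b, (z ∈ E ↔ (a, b) ∈ G)) :
    |(Measure.pi fun _ : Fin m => ν).real E - ∑ q ∈ G, patternMass (q.2⁻¹ * q.1) ν|
      ≤ 2 * m ^ 2 * ε := by
  set P := Measure.pi fun _ : Fin m => ν
  have hU : P.real (⋃ q ∈ G, sortedBy q.1 q.2) = ∑ q ∈ G, patternMass (q.2⁻¹ * q.1) ν := by
    rw [measureReal_biUnion_finset]
    · exact Finset.sum_congr rfl fun q _ => measureReal_sortedBy _ _ _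
    · intro q _ q' _ hne
      refine Set.disjoint_left.2 fun z hz hz' => hne ?_
      obtain ⟨h1, h2⟩ := sortedBy_disjoint hz hz'
      exact Prod.ext h1 h2
    · exact fun q _ => measurableSet_sortedBy _ _
  have h1 : (⋃ q ∈ G, sortedBy q.1 q.2) ⊆ E := by
    intro z hz
    simp only [mem_iUnion] at hz
    obtain ⟨q, hq, hz⟩ := hz
    exact (hG _ _ z hz).2 hq
  -- A tuple without ties is sorted in each coordinate by some permutation, so it lies in one of the
  -- events `sortedBy a b`.
  have h2 : E ⊆ (⋃ q ∈ G, sortedBy q.1 q.2) ∪ ties m := by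
    intro z hz
    by_cases ht : z ∈ ties m
    · exact Or.inr ht
    · simp only [ties, mem_ofPred_eq, not_not] at ht
      obtain ⟨a, ha⟩ := exists_strictMono_comp_perm ht.1
      obtain ⟨b, hb⟩ := exists_strictMono_comp_perm ht.2
      refine Or.inl ?_
      simp only [mem_iUnion]
      exact ⟨(a, b), (hG a b z ⟨ha, hb⟩).1 hz, ha, hb⟩
  have h3 : P.real (⋃ q ∈ G, sortedBy q.1 q.2) ≤ P.real E := measureReal_mono h1
  have h4 : P.real E ≤ P.real (⋃ q ∈ G, sortedBy q.1 q.2) + P.real (ties m) :=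
    (measureReal_mono h2).trans (measureReal_union_le _ _)
  have h5 := measureReal_ties_le h m
  rw [← hU, abs_of_nonneg (by linarith)]
  linarith

/-! ### Moments -/

/-- The event that the first point exceeds every other point in a prescribed coordinate. -/
def dominates {N : ℕ} (p : Fin N → Bool) : Set (Fin (N + 1) → I × I) :=
  {z | ∀ i, if p i then (z i.succ).1 < (z 0).1 else (z i.succ).2 < (z 0).2}

theorem measurableSet_dominates {N : ℕ} (p : Fin N → Bool) : MeasurableSet (dominates p) := by
  simp only [dominates, ofPred_forall]
  refine MeasurableSet.iInter fun i => ?_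
  cases p i
  · exact measurableSet_lt (measurable_pi_apply _).snd (measurable_pi_apply _).snd
  · exact measurableSet_lt (measurable_pi_apply _).fst (measurable_pi_apply _).fst

/-- Given the first point `q`, the other points are independent, and each lies below `q` in its
prescribed coordinate with probability within `ε` of that coordinate of `q`. The product of these
`N` probabilities is integrated over `q`. -/
theorem abs_measureReal_dominates_sub_integral_le {ν : Measure (I × I)} [IsProbabilityMeasure ν]
    {ε : ℝ} (h : NearPermuton ε ν) {N : ℕ} (p : Fin N → Bool) :
    |(Measure.pi fun _ : Fin (N + 1) => ν).real (dominates p) -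
      ∫ q, ∏ i, (if p i then (q.1 : ℝ) else q.2) ∂ν| ≤ N * ε := by
  let t : I × I → Fin N → Set (I × I) := fun q i =>
    if p i then Prod.fst ⁻¹' Iio q.1 else Prod.snd ⁻¹' Iio q.2
  have hm := measurableSet_dominates p
  have hsec : ∀ q : I × I, {w : Fin N → I × I | (0 : Fin (N + 1)).insertNth (α := fun _ => I × I) q w ∈ dominates p}
      = Set.pi univ (t q) := by
    intro q
    ext w
    simp only [dominates, mem_ofPred_eq, Set.mem_pi, mem_univ, true_imp_iff, t]
    refine forall_congr' fun i => ?_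
    cases p i <;> simp
  have h1 : (Measure.pi fun _ : Fin (N + 1) => ν) (dominates p) = ∫⁻ q, ∏ i, ν (t q i) ∂ν := by
    rw [pi_apply_eq_lintegral_one (fun _ => ν) 0 hm]
    refine lintegral_congr fun q => ?_
    rw [hsec, Measure.pi_pi]
  have hmeas : AEMeasurable (fun q => ∏ i, ν (t q i)) ν := by
    refine Finset.aemeasurable_fun_prod _ fun i _ => ?_
    have hmono : ∀ f : I × I → I, Measurable f → Measurable fun q => ν (f ⁻¹' Iio (f q)) := by
      intro f hf
      have : Monotone fun a : I => ν (f ⁻¹' Iio a) :=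
        fun a b hab => measure_mono (preimage_mono (Iio_subset_Iio hab))
      exact this.measurable.comp hf
    simp only [t]
    cases p i
    · simpa using (hmono _ measurable_snd).aemeasurable
    · simpa using (hmono _ measurable_fst).aemeasurable
  have h2 : (Measure.pi fun _ : Fin (N + 1) => ν).real (dominates p)
      = ∫ q, ∏ i, ν.real (t q i) ∂ν := by
    rw [Measure.real, h1, ← integral_toReal hmeas]
    · simp [ENNReal.toReal_prod, Measure.real]
    · refine ae_of_all _ fun q => ?_
      exact ENNReal.prod_lt_top fun i _ => measure_lt_top _ _
  have hbd : ∀ q : I × I, |∏ i, ν.real (t q i) - ∏ i, (if p i then (q.1 : ℝ) else q.2)| ≤ N * ε := by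
    intro q
    have := abs_prod_sub_prod_le (Finset.univ : Finset (Fin N)) (f := fun i => ν.real (t q i))
      (g := fun i => if p i then (q.1 : ℝ) else q.2) (δ := ε)
      (fun i => ⟨measureReal_nonneg, measureReal_le_one⟩)
      (fun i => by cases p i <;> simp) (fun i => by
        have e1 := h.fst.abs_Iio_sub_le q.1
        have e2 := h.snd.abs_Iio_sub_le q.2
        rw [map_measureReal_apply measurable_fst measurableSet_Iio] at e1
        rw [map_measureReal_apply measurable_snd measurableSet_Iio] at e2
        simp only [t]
        cases p i
        · simpa using e2
        · simpa using e1)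
    simpa using this
  have hi1 : Integrable (fun q => ∏ i, ν.real (t q i)) ν := by
    refine Integrable.of_bound (C := 1) ?_ (ae_of_all _ fun q => ?_)
    · have := hmeas.ennreal_toReal
      simp only [ENNReal.toReal_prod] at this
      exact this.aestronglyMeasurable
    · rw [Real.norm_eq_abs, abs_of_nonneg (Finset.prod_nonneg fun i _ => measureReal_nonneg)]
      exact Finset.prod_le_one (fun i _ => measureReal_nonneg) fun i _ => measureReal_le_one
  have hc : Continuous fun q : I × I => ∏ i, (if p i then (q.1 : ℝ) else q.2) := by
    refine continuous_finsetProd _ fun i _ => ?_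
    cases p i <;> simp <;> fun_prop
  have hi2 : Integrable (fun q : I × I => ∏ i, (if p i then (q.1 : ℝ) else q.2)) ν :=
    hc.integrable_of_hasCompactSupport (HasCompactSupport.of_compactSpace _)
  rw [h2, ← integral_sub hi1 hi2, ← Real.norm_eq_abs]
  refine (norm_integral_le_of_norm_le_const (μ := ν) (C := N * ε) (ae_of_all _ hbd)).trans ?_
  simp

open scoped BoundedContinuousFunction

theorem tendsto_moment {ν : ℕ → Measure (I × I)} [∀ n, IsProbabilityMeasure (ν n)]
    {μ : Measure (I × I)} [IsProbabilityMeasure μ] {ε : ℕ → ℝ} (hε : Tendsto ε atTop (𝓝 0))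
    (hν : ∀ n, NearPermuton (ε n) (ν n)) (hμ : NearPermuton 0 μ)
    (h : ∀ (m : ℕ) (τ : Equiv.Perm (Fin (m + 1))),
      Tendsto (fun n => patternMass τ (ν n)) atTop (𝓝 (patternMass τ μ)))
    {N : ℕ} (p : Fin N → Bool) :
    Tendsto (fun n => ∫ q, ∏ i, (if p i then (q.1 : ℝ) else q.2) ∂ν n) atTop
      (𝓝 (∫ q, ∏ i, (if p i then (q.1 : ℝ) else q.2) ∂μ)) := by
  classical
  let G : Finset (Equiv.Perm (Fin (N + 1)) × Equiv.Perm (Fin (N + 1))) :=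
    Finset.univ.filter fun q => ∀ i : Fin N,
      if p i then q.1⁻¹ i.succ < q.1⁻¹ 0 else q.2⁻¹ i.succ < q.2⁻¹ 0
  have hG : ∀ a b, ∀ z ∈ sortedBy a b, (z ∈ dominates p ↔ (a, b) ∈ G) := by
    intro a b z hz
    simp only [dominates, mem_ofPred_eq, G, Finset.mem_filter, Finset.mem_univ, true_and]
    refine forall_congr' fun i => ?_
    have h1 := hz.1.lt_iff_lt (a := a⁻¹ i.succ) (b := a⁻¹ 0)
    have h2 := hz.2.lt_iff_lt (a := b⁻¹ i.succ) (b := b⁻¹ 0)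
    rw [← Equiv.Perm.mul_apply, ← Equiv.Perm.mul_apply, mul_inv_cancel] at h1 h2
    cases p i
    · simpa using h2
    · simpa using h1
  set D : Measure (I × I) → ℝ := fun ρ => ∑ q ∈ G, patternMass (q.2⁻¹ * q.1) ρ
  set M : Measure (I × I) → ℝ := fun ρ => ∫ q, ∏ i, (if p i then (q.1 : ℝ) else q.2) ∂ρ
  -- The term `N * δ` replaces the probability of `dominates p` by the moment; the term `2 * (N + 1)
  -- ^ 2 * δ` accounts for ties among `N + 1` points.
  have key : ∀ (ρ : Measure (I × I)) [IsProbabilityMeasure ρ] (δ : ℝ), NearPermuton δ ρ →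
      |M ρ - D ρ| ≤ (N + 2 * ((N + 1 : ℕ) : ℝ) ^ 2) * δ := by
    intro ρ _ δ hρ
    have e1 := abs_measureReal_dominates_sub_integral_le hρ p
    have e2 := abs_measureReal_sub_sum_patternMass_le hρ hG
    rw [abs_le] at e1 e2 ⊢
    constructor <;> simp only [M, D] <;> nlinarith
  have hD : Tendsto (fun n => D (ν n)) atTop (𝓝 (D μ)) :=
    tendsto_finsetSum _ fun q _ => h _ _
  have hMμ : M μ = D μ := by
    have := key μ 0 hμ
    rw [mul_zero] at this
    exact sub_eq_zero.1 (abs_nonpos_iff.1 this)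
  have hdiff : Tendsto (fun n => M (ν n) - D (ν n)) atTop (𝓝 0) := by
    refine squeeze_zero_norm (fun n => key (ν n) (ε n) (hν n)) ?_
    simpa using hε.const_mul _
  have := hdiff.add hD
  simp only [sub_add_cancel, zero_add, ← hMμ] at this
  exact this

/-! ### Weak convergence from convergence of moments -/

/-- The first coordinate of the square as a bounded continuous function. -/
def coordFst : (I × I) →ᵇ ℝ :=
  BoundedContinuousFunction.mkOfCompact ⟨fun q => (q.1 : ℝ), by fun_prop⟩

/-- The second coordinate of the square as a bounded continuous function. -/
def coordSnd : (I × I) →ᵇ ℝ :=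
  BoundedContinuousFunction.mkOfCompact ⟨fun q => (q.2 : ℝ), by fun_prop⟩

theorem prod_ite_lt_eq_pow (a b : ℕ) (x y : ℝ) :
    ∏ i : Fin (a + b), (if decide ((i : ℕ) < a) then x else y) = x ^ a * y ^ b := by
  rw [Fin.prod_univ_add]
  simp

/-- The square is compact, so tightness is automatic, and the polynomials in the two coordinates
form an algebra separating points. By linearity it is enough to test on monomials. -/
theorem tendsto_probabilityMeasure_of_moments {ν : ℕ → ProbabilityMeasure (I × I)}
    {μ : ProbabilityMeasure (I × I)}
    (h : ∀ a b : ℕ, Tendsto (fun n => ∫ q, (q.1 : ℝ) ^ a * (q.2 : ℝ) ^ b ∂(ν n : Measure (I × I)))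
      atTop (𝓝 (∫ q, (q.1 : ℝ) ^ a * (q.2 : ℝ) ^ b ∂(μ : Measure (I × I))))) :
    Tendsto ν atTop (𝓝 μ) := by
  let A : StarSubalgebra ℝ ((I × I) →ᵇ ℝ) :=
    { Algebra.adjoin ℝ {coordFst, coordSnd} with
      star_mem' := fun {f} hf => by
        have : star f = f := by ext q; simp
        rw [this]; exact hf }
  refine ProbabilityMeasure.tendsto_of_tight_of_separatesPoints ℝ (A := A)
    IsTightMeasureSet.of_compactSpace ?_ ?_
  · intro x y hxy
    have hA : ∀ f ∈ ({coordFst, coordSnd} : Set ((I × I) →ᵇ ℝ)), f ∈ A :=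
      fun f hf => Algebra.subset_adjoin hf
    by_cases h1 : x.1 = y.1
    · have h2 : x.2 ≠ y.2 := fun h2 => hxy (Prod.ext h1 h2)
      refine ⟨_, ⟨_, ⟨coordSnd, hA _ (by simp), rfl⟩, rfl⟩, ?_⟩
      exact fun h => h2 (Subtype.ext h)
    · refine ⟨_, ⟨_, ⟨coordFst, hA _ (by simp), rfl⟩, rfl⟩, ?_⟩
      exact fun h => h1 (Subtype.ext h)
  · intro g hg
    have hg' : g ∈ Submodule.span ℝ (Submonoid.closure {coordFst, coordSnd} : Set ((I × I) →ᵇ ℝ)) := by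
      rw [← Algebra.adjoin_eq_span]; exact hg
    clear hg
    induction hg' using Submodule.span_induction with
    | mem f hf =>
      obtain ⟨a, b, rfl⟩ := (Submonoid.mem_closure_pair _ _ _).1 hf
      exact h a b
    | zero => simp
    | add f g _ _ hf hg =>
      have e : ∀ ρ : ProbabilityMeasure (I × I), ∫ q, (f + g) q ∂(ρ : Measure (I × I)) =
          ∫ q, f q ∂(ρ : Measure (I × I)) + ∫ q, g q ∂(ρ : Measure (I × I)) := fun ρ =>
        integral_add (f.integrable _) (g.integrable _)
      simp only [e]
      exact hf.add hg
    | smul c f _ hf =>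
      have e : ∀ ρ : ProbabilityMeasure (I × I), ∫ q, (c • f) q ∂(ρ : Measure (I × I)) =
          c * ∫ q, f q ∂(ρ : Measure (I × I)) := fun ρ => integral_const_mul _ _
      simp only [e]
      exact hf.const_mul c

/-! ### Uniform convergence on rectangles -/

/-- The closed rectangle with the given sides. -/
def rect (r : (I × I) × (I × I)) : Set (I × I) := Icc r.1.1 r.1.2 ×ˢ Icc r.2.1 r.2.2

theorem measurableSet_rect (r : (I × I) × (I × I)) : MeasurableSet (rect r) :=
  measurableSet_Icc.prod measurableSet_Icc

theorem NearUniform.uIcc_le {ε : ℝ} {ρ : Measure I} (h : NearUniform ε ρ) (a b : I) :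
    ρ.real (uIcc a b) ≤ dist a b + ε := by
  refine (h.Icc_le _ _ inf_le_sup).trans_eq ?_
  rw [Icc.coe_sup, Icc.coe_inf, max_sub_min_eq_abs', Subtype.dist_eq, Real.dist_eq]

/-- A point of the first rectangle outside the second lies in one of four strips between
corresponding sides, each of mass at most its width plus `ε`. This is equicontinuity in the
rectangle, up to `ε`. -/
theorem NearPermuton.measureReal_rect_le {ε : ℝ} {ν : Measure (I × I)} [IsProbabilityMeasure ν]
    (h : NearPermuton ε ν) (r s : (I × I) × (I × I)) :
    ν.real (rect r) ≤ ν.real (rect s) + (4 * dist r s + 4 * ε) := by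
  have hsub : rect r ⊆ rect s ∪ ((Prod.fst ⁻¹' uIcc r.1.1 s.1.1 ∪ Prod.fst ⁻¹' uIcc r.1.2 s.1.2) ∪
      (Prod.snd ⁻¹' uIcc r.2.1 s.2.1 ∪ Prod.snd ⁻¹' uIcc r.2.2 s.2.2)) := by
    rintro ⟨x, y⟩ ⟨⟨h1, h2⟩, h3, h4⟩
    simp only [rect, mem_union, mem_prod, mem_Icc, mem_preimage, mem_uIcc] at h1 h2 h3 h4 ⊢
    by_cases k1 : s.1.1 ≤ x
    · by_cases k2 : x ≤ s.1.2
      · by_cases k3 : s.2.1 ≤ y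
        · by_cases k4 : y ≤ s.2.2
          · exact Or.inl ⟨⟨k1, k2⟩, k3, k4⟩
          · exact Or.inr (Or.inr (Or.inr (Or.inr ⟨le_of_not_ge k4, h4⟩)))
        · exact Or.inr (Or.inr (Or.inl (Or.inl ⟨h3, le_of_not_ge k3⟩)))
      · exact Or.inr (Or.inl (Or.inr (Or.inr ⟨le_of_not_ge k2, h2⟩)))
    · exact Or.inr (Or.inl (Or.inl (Or.inl ⟨h1, le_of_not_ge k1⟩)))
  have hf : ∀ a b : I, ν.real (Prod.fst ⁻¹' uIcc a b) ≤ dist a b + ε := fun a b => by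
    have := h.fst.uIcc_le a b
    rwa [map_measureReal_apply measurable_fst measurableSet_uIcc] at this
  have hs : ∀ a b : I, ν.real (Prod.snd ⁻¹' uIcc a b) ≤ dist a b + ε := fun a b => by
    have := h.snd.uIcc_le a b
    rwa [map_measureReal_apply measurable_snd measurableSet_uIcc] at this
  have h0 := measureReal_mono (μ := ν) hsub
  have h1 := measureReal_union_le (μ := ν) (rect s) ((Prod.fst ⁻¹' uIcc r.1.1 s.1.1 ∪
    Prod.fst ⁻¹' uIcc r.1.2 s.1.2) ∪ (Prod.snd ⁻¹' uIcc r.2.1 s.2.1 ∪ Prod.snd ⁻¹' uIcc r.2.2 s.2.2))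
  have h2 := measureReal_union_le (μ := ν) (Prod.fst ⁻¹' uIcc r.1.1 s.1.1 ∪
    Prod.fst ⁻¹' uIcc r.1.2 s.1.2) (Prod.snd ⁻¹' uIcc r.2.1 s.2.1 ∪ Prod.snd ⁻¹' uIcc r.2.2 s.2.2)
  have h3 := measureReal_union_le (μ := ν) (Prod.fst ⁻¹' uIcc r.1.1 s.1.1) (Prod.fst ⁻¹' uIcc r.1.2 s.1.2)
  have h4 := measureReal_union_le (μ := ν) (Prod.snd ⁻¹' uIcc r.2.1 s.2.1) (Prod.snd ⁻¹' uIcc r.2.2 s.2.2)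
  have d1 : dist r.1.1 s.1.1 ≤ dist r s := (le_max_left _ _).trans (le_max_left _ _)
  have d2 : dist r.1.2 s.1.2 ≤ dist r s := (le_max_right _ _).trans (le_max_left _ _)
  have d3 : dist r.2.1 s.2.1 ≤ dist r s := (le_max_left _ _).trans (le_max_right _ _)
  have d4 : dist r.2.2 s.2.2 ≤ dist r s := (le_max_right _ _).trans (le_max_right _ _)
  linarith [hf r.1.1 s.1.1, hf r.1.2 s.1.2, hs r.2.1 s.2.1, hs r.2.2 s.2.2]

theorem NearPermuton.abs_measureReal_rect_sub_le {ε : ℝ} {ν : Measure (I × I)}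
    [IsProbabilityMeasure ν] (h : NearPermuton ε ν) (r s : (I × I) × (I × I)) :
    |ν.real (rect r) - ν.real (rect s)| ≤ 4 * dist r s + 4 * ε := by
  have h1 := h.measureReal_rect_le r s
  have h2 := h.measureReal_rect_le s r
  rw [dist_comm] at h2
  rw [abs_le]
  constructor <;> linarith

/-- For `ε = 0` the marginals have no atoms, and the frontier projects to endpoints of the sides. -/
theorem NearPermuton.frontier_rect {μ : Measure (I × I)} [IsProbabilityMeasure μ]
    (h : NearPermuton 0 μ) (r : (I × I) × (I × I)) : μ (frontier (rect r)) = 0 := by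
  have hI : ∀ a b : I, frontier (Icc a b) ⊆ {a, b} := by
    intro a b x hx
    rw [isClosed_Icc.frontier_eq] at hx
    by_contra hne
    simp only [mem_insert_iff, mem_singleton_iff, not_or] at hne
    refine hx.2 (mem_interior.2 ⟨Ioo a b, Ioo_subset_Icc_self, isOpen_Ioo, ?_⟩)
    exact ⟨lt_of_le_of_ne hx.1.1 (Ne.symm hne.1), lt_of_le_of_ne hx.1.2 hne.2⟩
  have hz : ∀ {ρ : Measure I}, NearUniform 0 ρ → ∀ a b : I, ρ {a, b} = 0 := by
    intro ρ hρ a b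
    have := hρ.isProb
    have h1 : ∀ c : I, ρ {c} = 0 := fun c =>
      (measureReal_eq_zero_iff).1 (le_antisymm (hρ.singleton_le c) measureReal_nonneg)
    rw [insert_eq]
    exact measure_union_null (h1 a) (h1 b)
  have hsub : frontier (rect r) ⊆ Prod.fst ⁻¹' {r.1.1, r.1.2} ∪ Prod.snd ⁻¹' {r.2.1, r.2.2} := by
    rw [rect, frontier_prod_eq]
    rintro ⟨x, y⟩ (hx | hx)
    · exact Or.inr (hI _ _ hx.2)
    · exact Or.inl (hI _ _ hx.1)
  refine measure_mono_null hsub (measure_union_null ?_ ?_)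
  · rw [← Measure.map_apply measurable_fst ((finite_singleton _).insert _).measurableSet]
    exact hz h.fst _ _
  · rw [← Measure.map_apply measurable_snd ((finite_singleton _).insert _).measurableSet]
    exact hz h.snd _ _

/-- If all pattern probabilities converge, then the masses of rectangles converge uniformly. -/
theorem tendstoUniformly_rect {ν : ℕ → Measure (I × I)} [∀ n, IsProbabilityMeasure (ν n)]
    {μ : Measure (I × I)} [IsProbabilityMeasure μ] {ε : ℕ → ℝ} (hε : Tendsto ε atTop (𝓝 0))
    (hν : ∀ n, NearPermuton (ε n) (ν n)) (hμ : NearPermuton 0 μ)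
    (h : ∀ (m : ℕ) (τ : Equiv.Perm (Fin (m + 1))),
      Tendsto (fun n => patternMass τ (ν n)) atTop (𝓝 (patternMass τ μ))) :
    TendstoUniformly (fun n r => (ν n).real (rect r)) (fun r => μ.real (rect r)) atTop := by
  let ν' : ℕ → ProbabilityMeasure (I × I) := fun n => ⟨ν n, inferInstance⟩
  let μ' : ProbabilityMeasure (I × I) := ⟨μ, inferInstance⟩
  have hweak : Tendsto ν' atTop (𝓝 μ') := by
    refine tendsto_probabilityMeasure_of_moments fun a b => ?_
    have := tendsto_moment hε hν hμ h (fun i : Fin (a + b) => decide ((i : ℕ) < a))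
    simp only [prod_ite_lt_eq_pow] at this
    exact this
  have hpt : ∀ r, Tendsto (fun n => (ν n).real (rect r)) atTop (𝓝 (μ.real (rect r))) := by
    intro r
    have := ProbabilityMeasure.tendsto_measure_of_null_frontier_of_tendsto' hweak
      (hμ.frontier_rect r)
    exact (ENNReal.tendsto_toReal (measure_ne_top _ _)).comp this
  -- The parameters of rectangles, degenerate ones included, form a compact space.
  rw [← tendstoLocallyUniformly_iff_tendstoUniformly_of_compactSpace,
    Metric.tendstoLocallyUniformly_iff]
  intro δ hδ r
  -- Moving from `s` to `r` costs at most `δ / 8 + δ / 4` for `ν n` and `δ / 8` for `μ`; with `δ /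
  -- 4` at `r` itself the total stays below `δ`.
  refine ⟨Metric.ball r (δ / 32), Metric.ball_mem_nhds _ (by positivity), ?_⟩
  filter_upwards [hε.eventually (gt_mem_nhds (show (0 : ℝ) < δ / 16 by positivity)),
    Metric.tendsto_nhds.1 (hpt r) (δ / 4) (by positivity)] with n h1 h2 s hs
  rw [Metric.mem_ball] at hs
  have e1 := (hν n).abs_measureReal_rect_sub_le s r
  have e2 := hμ.abs_measureReal_rect_sub_le s r
  rw [Real.dist_eq] at h2 ⊢
  rw [abs_le] at e1 e2
  rw [abs_lt] at h2 ⊢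
  constructor <;> linarith

/-! ### Pattern probabilities and the discrepancy on rectangles -/

theorem exists_Icc_of_isCompact_subset {A K : Set I} (hA : IsOpen A) (hc : A.OrdConnected)
    (hne : A.Nonempty) (hK : IsCompact K) (hKA : K ⊆ A) :
    ∃ a b : I, a < b ∧ K ⊆ Icc a b ∧ Icc a b ⊆ A := by
  obtain ⟨x, hx⟩ := hne
  -- Two distinct points of `A` are added to `K` so that the enclosing interval is nondegenerate,
  -- even for empty `K`.
  obtain ⟨p, hp, q, hq, hpq⟩ := (infinite_of_mem_nhds x (hA.mem_nhds hx)).nontrivial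
  have hK' : IsCompact (K ∪ {p, q}) := hK.union ((finite_singleton q).insert p).isCompact
  have hne' : (K ∪ {p, q}).Nonempty := ⟨p, by simp⟩
  have hsub : K ∪ {p, q} ⊆ A := union_subset hKA (by simp [insert_subset_iff, hp, hq])
  obtain ⟨a, ha, ha'⟩ := hK'.exists_isLeast hne'
  obtain ⟨b, hb, hb'⟩ := hK'.exists_isGreatest hne'
  refine ⟨a, b, ?_, fun y hy => ⟨ha' (Or.inl hy), hb' (Or.inl hy)⟩, hc.out (hsub ha) (hsub hb)⟩
  rcases lt_or_gt_of_ne hpq with h | h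
  · exact (ha' (by simp : p ∈ K ∪ {p, q})).trans_lt (h.trans_le (hb' (by simp)))
  · exact (ha' (by simp : q ∈ K ∪ {p, q})).trans_lt (h.trans_le (hb' (by simp)))

/-- By inner regularity almost all the mass sits on a compact subset of `A ×ˢ B`, which fits into a
closed rectangle inside `A ×ˢ B`. -/
theorem measureReal_openRect_le {ν μ : Measure (I × I)} [IsProbabilityMeasure ν]
    [IsProbabilityMeasure μ] {D : ℝ}
    (h : ∀ x₁ x₂ y₁ y₂ : I, x₁ < x₂ → y₁ < y₂ →
      |ν.real (rect ((x₁, x₂), (y₁, y₂))) - μ.real (rect ((x₁, x₂), (y₁, y₂)))| ≤ D)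
    {A B : Set I} (hA : IsOpen A) (hA' : A.OrdConnected) (hB : IsOpen B) (hB' : B.OrdConnected) :
    ν.real (A ×ˢ B) ≤ μ.real (A ×ˢ B) + D := by
  have hD : 0 ≤ D := (abs_nonneg _).trans (h 0 1 0 1 zero_lt_one zero_lt_one)
  refine le_of_forall_lt fun r hr => ?_
  rcases lt_or_ge r 0 with hr0 | hr0
  · exact hr0.trans_le (add_nonneg measureReal_nonneg hD)
  obtain ⟨K, hKU, hK, hrK⟩ := (hA.prod hB).exists_lt_isCompact (μ := ν)
    ((ENNReal.ofReal_lt_iff_lt_toReal hr0 (measure_ne_top _ _)).2 hr)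
  have hne : (A ×ˢ B).Nonempty := by
    rw [nonempty_iff_ne_empty]
    intro he
    rw [he, measureReal_empty] at hr
    exact absurd hr (not_lt.2 hr0)
  obtain ⟨x₁, x₂, hx, hx1, hx2⟩ := exists_Icc_of_isCompact_subset hA hA' hne.fst
    (hK.image continuous_fst) (image_subset_iff.2 fun z hz => (hKU hz).1)
  obtain ⟨y₁, y₂, hy, hy1, hy2⟩ := exists_Icc_of_isCompact_subset hB hB' hne.snd
    (hK.image continuous_snd) (image_subset_iff.2 fun z hz => (hKU hz).2)
  have h1 : r < ν.real (rect ((x₁, x₂), (y₁, y₂))) := by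
    rw [ENNReal.ofReal_lt_iff_lt_toReal hr0 (measure_ne_top _ _)] at hrK
    refine hrK.trans_le (measureReal_mono fun z hz => ⟨?_, ?_⟩)
    · exact hx1 (mem_image_of_mem _ hz)
    · exact hy1 (mem_image_of_mem _ hz)
  have h2 : μ.real (rect ((x₁, x₂), (y₁, y₂))) ≤ μ.real (A ×ˢ B) :=
    measureReal_mono (prod_mono hx2 hy2)
  have h3 := (abs_le.1 (h x₁ x₂ y₁ y₂ hx hy)).2
  linarith

theorem abs_measureReal_openRect_sub_le {ν μ : Measure (I × I)} [IsProbabilityMeasure ν]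
    [IsProbabilityMeasure μ] {D : ℝ}
    (h : ∀ x₁ x₂ y₁ y₂ : I, x₁ < x₂ → y₁ < y₂ →
      |ν.real (rect ((x₁, x₂), (y₁, y₂))) - μ.real (rect ((x₁, x₂), (y₁, y₂)))| ≤ D)
    {A B : Set I} (hA : IsOpen A) (hA' : A.OrdConnected) (hB : IsOpen B) (hB' : B.OrdConnected) :
    |ν.real (A ×ˢ B) - μ.real (A ×ˢ B)| ≤ D := by
  have h1 := measureReal_openRect_le h hA hA' hB hB'
  have h2 := measureReal_openRect_le (ν := μ) (μ := ν)
    (fun x₁ x₂ y₁ y₂ hx hy => by rw [abs_sub_comm]; exact h x₁ x₂ y₁ y₂ hx hy) hA hA' hB hB'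
  rw [abs_le]
  constructor <;> linarith

/-- Each required inequality compares the moving variable with a constant, two constants, or the
variable with itself, so it cuts out an open order-convex set. -/
theorem strictMono_section {ι : Type*} [Finite ι] [Preorder ι] {f : I → ι → I}
    (hf : ∀ i, (∀ x, f x i = x) ∨ ∃ c, ∀ x, f x i = c) :
    IsOpen {x | StrictMono (f x)} ∧ {x | StrictMono (f x)}.OrdConnected := by
  constructor
  · have hc : ∀ i, Continuous fun x => f x i := fun i => by
      rcases hf i with h | ⟨c, h⟩
      · simpa only [h] using continuous_id'
      · simpa only [h] using continuous_const
    simp only [StrictMono, ofPred_forall]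
    exact isOpen_iInter_of_finite fun i => isOpen_iInter_of_finite fun j =>
      isOpen_iInter_of_finite fun _ => isOpen_lt (hc i) (hc j)
  · refine ⟨fun x hx y hy z hz i j hij => ?_⟩
    have h1 := hx hij
    have h2 := hy hij
    rcases hf i with hi | ⟨c, hi⟩ <;> rcases hf j with hj | ⟨d, hj⟩ <;> simp only [hi, hj] at h1 h2 ⊢
    · exact absurd h1 (lt_irrefl _)
    · exact hz.2.trans_lt h2
    · exact h1.trans_le hz.1
    · exact h1

/-- With the other points fixed, the two coordinates of the `k`-th point enter separate conditions,
so its admissible positions form a product of two open order-convex sets. The bound there is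
integrated over the common law of the other points. -/
theorem abs_pi_sortedBy_replace_le {N : ℕ} {α β : Fin (N + 1) → Measure (I × I)}
    [∀ i, IsProbabilityMeasure (α i)] [∀ i, IsProbabilityMeasure (β i)] {D : ℝ} (k : Fin (N + 1))
    (hk : ∀ j, j ≠ k → α j = β j)
    (h : ∀ x₁ x₂ y₁ y₂ : I, x₁ < x₂ → y₁ < y₂ →
      |(α k).real (rect ((x₁, x₂), (y₁, y₂))) - (β k).real (rect ((x₁, x₂), (y₁, y₂)))| ≤ D)
    (a b : Equiv.Perm (Fin (N + 1))) :
    |(Measure.pi α).real (sortedBy a b) - (Measure.pi β).real (sortedBy a b)| ≤ D := by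
  have hoth : (fun j => α (k.succAbove j)) = fun j => β (k.succAbove j) :=
    funext fun j => hk _ (Fin.succAbove_ne k j)
  let s : (Fin N → I × I) → Set (I × I) := fun w =>
    {p | k.insertNth (α := fun _ => I × I) p w ∈ sortedBy a b}
  set P : Measure (Fin N → I × I) := Measure.pi fun j => β (k.succAbove j) with hP
  have hmS : MeasurableSet {q : (I × I) × (Fin N → I × I) |
      k.insertNth (α := fun _ => I × I) q.1 q.2 ∈ sortedBy a b} :=
    (MeasurableEquiv.piFinSuccAbove (fun _ => I × I) k).symm.measurable (measurableSet_sortedBy a b)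
  have hmeas : ∀ (ρ : Measure (I × I)) [IsProbabilityMeasure ρ], Measurable fun w => ρ (s w) :=
    fun ρ _ => measurable_measure_prodMk_right hmS
  have hint : ∀ (ρ : Measure (I × I)) [IsProbabilityMeasure ρ],
      Integrable (fun w => ρ.real (s w)) P := fun ρ _ =>
    Integrable.of_bound (C := 1) (hmeas ρ).ennreal_toReal.aestronglyMeasurable
      (ae_of_all _ fun w => by
        rw [Real.norm_eq_abs, abs_of_nonneg measureReal_nonneg]; exact measureReal_le_one)
  have e : ∀ (γ : Fin (N + 1) → Measure (I × I)) [∀ i, IsProbabilityMeasure (γ i)],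
      (fun j => γ (k.succAbove j)) = (fun j => β (k.succAbove j)) →
      (Measure.pi γ).real (sortedBy a b) = ∫ w, (γ k).real (s w) ∂P := by
    intro γ _ hγ
    rw [Measure.real, pi_apply_eq_lintegral_others γ k (measurableSet_sortedBy a b), hγ, ← hP]
    exact (integral_toReal (hmeas (γ k)).aemeasurable (ae_of_all _ fun w => measure_lt_top _ _)).symm
  have hcoord : ∀ {X : Type} (w : Fin N → I × I) (c : Equiv.Perm (Fin (N + 1))) (g : I × I → X)
      (f : X → I × I) (_ : ∀ x, g (f x) = x) (i : Fin (N + 1)),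
      (∀ x, g (k.insertNth (α := fun _ => I × I) (f x) w (c i)) = x) ∨
        ∃ d, ∀ x, g (k.insertNth (α := fun _ => I × I) (f x) w (c i)) = d := by
    intro X w c g f hgf i
    by_cases hi : c i = k
    · refine Or.inl fun x => ?_
      rw [hi, Fin.insertNth_apply_same, hgf]
    · obtain ⟨j, hj⟩ := Fin.exists_succAbove_eq hi
      refine Or.inr ⟨g (w j), fun x => ?_⟩
      rw [← hj, Fin.insertNth_apply_succAbove]
  have hbd : ∀ w, |(α k).real (s w) - (β k).real (s w)| ≤ D := by
    intro w
    have hs : s w = {x : I | StrictMono fun i =>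
          (k.insertNth (α := fun _ => I × I) (x, (0 : I)) w (a i)).1} ×ˢ
        {y : I | StrictMono fun i =>
          (k.insertNth (α := fun _ => I × I) ((0 : I), y) w (b i)).2} := by
      have hfst : ∀ (x y y' : I) (i : Fin (N + 1)),
          (k.insertNth (α := fun _ => I × I) (x, y) w i).1 =
            (k.insertNth (α := fun _ => I × I) (x, y') w i).1 := by
        intro x y y' i
        rcases Fin.eq_self_or_eq_succAbove k i with rfl | ⟨j, rfl⟩ <;> simp
      have hsnd : ∀ (x x' y : I) (i : Fin (N + 1)),
          (k.insertNth (α := fun _ => I × I) (x, y) w i).2 =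
            (k.insertNth (α := fun _ => I × I) (x', y) w i).2 := by
        intro x x' y i
        rcases Fin.eq_self_or_eq_succAbove k i with rfl | ⟨j, rfl⟩ <;> simp
      ext ⟨x, y⟩
      simp only [s, sortedBy, mem_ofPred_eq, mem_prod, hfst x y 0, hsnd x 0 y]
    rw [hs]
    obtain ⟨hA, hA'⟩ := strictMono_section (hcoord w a Prod.fst (fun x => (x, (0 : I))) fun _ => rfl)
    obtain ⟨hB, hB'⟩ := strictMono_section (hcoord w b Prod.snd (fun y => ((0 : I), y)) fun _ => rfl)
    exact abs_measureReal_openRect_sub_le h hA hA' hB hB'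
  rw [e α hoth, e β rfl, ← integral_sub (hint _) (hint _), ← Real.norm_eq_abs]
  refine (norm_integral_le_of_norm_le_const (μ := P) (C := D) (ae_of_all _ hbd)).trans ?_
  simp

/-- Pattern probabilities are Lipschitz with respect to the rectangular distance. -/
theorem abs_patternMass_sub_le {ν μ : Measure (I × I)} [IsProbabilityMeasure ν]
    [IsProbabilityMeasure μ] {D : ℝ}
    (h : ∀ x₁ x₂ y₁ y₂ : I, x₁ < x₂ → y₁ < y₂ →
      |ν.real (rect ((x₁, x₂), (y₁, y₂))) - μ.real (rect ((x₁, x₂), (y₁, y₂)))| ≤ D)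
    {m : ℕ} (τ : Equiv.Perm (Fin m)) : |patternMass τ ν - patternMass τ μ| ≤ m * D := by
  obtain _ | N := m
  · have : ∀ ρ : Measure (I × I), (Measure.pi fun _ : Fin 0 => ρ) = Measure.pi fun _ => ν :=
      fun ρ => congrArg _ (Subsingleton.elim _ _)
    simp [patternMass, this μ]
  -- Hybrid laws: the points with index below `k` are drawn from `ν`, the others from `μ`.
  let γ : ℕ → Fin (N + 1) → Measure (I × I) := fun k j => if (j : ℕ) < k then ν else μ
  have hγ : ∀ k j, IsProbabilityMeasure (γ k j) := fun k j => by
    simp only [γ]; split_ifs <;> infer_instance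
  let F : ℕ → ℝ := fun k => (Measure.pi (γ k)).real (sortedBy 1 τ⁻¹)
  have hstep : ∀ k, k < N + 1 → |F (k + 1) - F k| ≤ D := by
    intro k hk
    refine abs_pi_sortedBy_replace_le ⟨k, hk⟩ (fun j hj => ?_) ?_ _ _
    · have : (j : ℕ) ≠ k := fun e => hj (Fin.ext e)
      have : (j : ℕ) < k + 1 ↔ (j : ℕ) < k := by omega
      simp only [γ, this]
    · simpa [γ] using h
  have hind : ∀ k, k ≤ N + 1 → |F k - F 0| ≤ k * D := by
    intro k
    induction k with
    | zero => simp
    | succ k ih =>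
      intro hk
      have h1 := ih (by omega)
      have h2 := hstep k (by omega)
      have h3 := abs_sub_le (F (k + 1)) (F k) (F 0)
      push_cast
      linarith
  have h1 : F 0 = patternMass τ μ := by simp [F, γ, patternMass]
  have h2 : F (N + 1) = patternMass τ ν := by
    have : γ (N + 1) = fun _ => ν := funext fun j => if_pos j.2
    simp only [F, this, patternMass]
  rw [← h1, ← h2]
  exact hind _ le_rfl

open ProbabilityTheory

/-! ### The measure of a limit permutation -/

theorem isProbabilityMeasure_cdfMeasure {F : I → I} (hF : IsCdf F) :
    IsProbabilityMeasure (cdfMeasure F) := ⟨cdfMeasure_univ hF⟩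

theorem Iio_eq_Ico_zero (y : I) : Iio y = Ico 0 y := by
  ext x
  simp

theorem cdfMeasure_Iio {F : I → I} (hF : IsCdf F) (y : I) :
    cdfMeasure F (Iio y) = ENNReal.ofReal (F y) := by
  rw [Iio_eq_Ico_zero, cdfMeasure_Ico hF, hF.map_zero]
  simp

theorem ext_of_Iio {ρ ρ' : Measure I} [IsProbabilityMeasure ρ] [IsProbabilityMeasure ρ']
    (h : ∀ y, ρ (Iio y) = ρ' (Iio y)) : ρ = ρ' := by
  refine Measure.ext_of_Ici _ _ fun y => ?_
  rw [← compl_Iio, prob_compl_eq_one_sub measurableSet_Iio, prob_compl_eq_one_sub measurableSet_Iio, h]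

theorem cdf_eq_of_cdfMeasure_eq {F G : I → I} (hF : IsCdf F) (hG : IsCdf G)
    (h : cdfMeasure F = cdfMeasure G) : F = G := by
  funext y
  have h1 := cdfMeasure_Iio hF y
  rw [h, cdfMeasure_Iio hG y, ENNReal.ofReal_eq_ofReal_iff (G y).2.1 (F y).2.1] at h1
  exact Subtype.ext h1.symm

/-- `Iio y` is the increasing union of the `Iio d` with `d < y` in `D`. Countability of `D` lets the
exceptional null sets of the sections be discarded together. -/
theorem measurable_of_measurable_Iio {κ : I → Measure I} [∀ x, IsProbabilityMeasure (κ x)]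
    {D : Set I} (hDc : D.Countable) (hD : Dense D) (h : ∀ d ∈ D, Measurable fun x => κ x (Iio d)) :
    Measurable κ := by
  refine Measurable.measure_of_isPiSystem_of_isProbabilityMeasure
    (S := range Iio) ?_ isPiSystem_Iio ?_
  · exact (BorelSpace.measurable_eq (α := I)).trans (borel_eq_generateFrom_Iio I)
  · rintro _ ⟨y, rfl⟩
    have hU : Iio y = ⋃ d ∈ D ∩ Iio y, Iio d := by
      ext x
      simp only [mem_Iio, mem_iUnion, mem_inter_iff, exists_prop]
      constructor
      · intro hx
        obtain ⟨d, hd, h1, h2⟩ := hD.exists_between hx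
        exact ⟨d, ⟨hd, h2⟩, h1⟩
      · rintro ⟨d, ⟨_, h2⟩, h1⟩
        exact h1.trans h2
    have hc : (D ∩ Iio y).Countable := hDc.mono inter_subset_left
    have hdir : DirectedOn (Function.onFun (fun s t : Set I => s ⊆ t) Iio) (D ∩ Iio y) := by
      intro a ha b hb
      rcases le_total a b with hab | hab
      · exact ⟨b, hb, Iio_subset_Iio hab, subset_rfl⟩
      · exact ⟨a, ha, subset_rfl, Iio_subset_Iio hab⟩
    have : ∀ x, κ x (Iio y) = ⨆ d ∈ D ∩ Iio y, κ x (Iio d) := fun x =>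
      (congrArg _ hU).trans (measure_biUnion_eq_iSup hc hdir)
    simp only [this]
    exact Measurable.biSup _ hc fun d hd => h d hd.1

theorem exists_kernel_ae_eq_cdfMeasure {W : I → I → I} (hW : ∀ x, IsCdf (W x))
    (hm : ∀ y, AEMeasurable (fun x => (W x y : ℝ))) :
    ∃ κ : Kernel I I, IsMarkovKernel κ ∧ ∀ᵐ x, κ x = cdfMeasure (W x) := by
  classical
  obtain ⟨D, hDc, hD⟩ := TopologicalSpace.exists_countable_dense I
  have hae : ∀ᵐ x, ∀ d ∈ D, (W x d : ℝ) = (hm d).mk _ x :=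
    (ae_ball_iff hDc).2 fun d _ => (hm d).ae_eq_mk
  obtain ⟨T, hT, hTm, hT0⟩ := exists_measurable_superset_of_null (ae_iff.1 hae)
  -- On the null set `T`, where some section with `d ∈ D` may differ from its measurable version, a
  -- Dirac mass is used instead.
  let κ : I → Measure I := fun x => if x ∈ T then Measure.dirac 0 else cdfMeasure (W x)
  have hκ : ∀ x, IsProbabilityMeasure (κ x) := fun x => by
    simp only [κ]
    split_ifs
    · infer_instance
    · exact isProbabilityMeasure_cdfMeasure (hW x)
  have hmeas : Measurable κ := by
    refine measurable_of_measurable_Iio hDc hD fun d hd => ?_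
    have : (fun x => κ x (Iio d)) =
        fun x => if x ∈ T then Measure.dirac 0 (Iio d) else ENNReal.ofReal ((hm d).mk _ x) := by
      funext x
      simp only [κ]
      split_ifs with hx
      · rfl
      · rw [cdfMeasure_Iio (hW x), not_not.1 (fun h => hx (hT h)) d hd]
    rw [this]
    exact Measurable.ite hTm measurable_const (hm d).measurable_mk.ennreal_ofReal
  refine ⟨⟨κ, hmeas⟩, ⟨hκ⟩, ?_⟩
  filter_upwards [measure_eq_zero_iff_ae_notMem.1 hT0] with x hx
  exact if_neg hx

namespace LimitPermutation

variable (Z : LimitPermutation)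

/-- Joint measurability says nothing about one fixed `y`. But the integral of a non-integrable
function is `0` by convention, so the value `y ≠ 0` forces integrability. -/
theorem aemeasurable_section (y : I) : AEMeasurable (fun x => (Z.toFun x y : ℝ)) := by
  by_cases hy : (y : ℝ) = 0
  · have : y = 0 := Subtype.ext hy
    simp [this, (Z.isCdf _).map_zero]
  · have h := Z.integral_eq y
    exact (Integrable.of_integral_ne_zero (h ▸ hy)).aestronglyMeasurable.aemeasurable

theorem exists_kernel : ∃ κ : Kernel I I, IsMarkovKernel κ ∧
    ∀ᵐ x, κ x = cdfMeasure (Z.toFun x) :=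
  exists_kernel_ae_eq_cdfMeasure Z.isCdf Z.aemeasurable_section

/-- A Markov kernel that almost everywhere agrees with the measures `dZ (x, ·)`. -/
def kernel : Kernel I I := Z.exists_kernel.choose

instance : IsMarkovKernel Z.kernel := Z.exists_kernel.choose_spec.1

theorem kernel_ae_eq : ∀ᵐ x, Z.kernel x = cdfMeasure (Z.toFun x) := Z.exists_kernel.choose_spec.2

/-- The measure on the unit square associated with a limit permutation. -/
def measure : Measure (I × I) := volume ⊗ₘ Z.kernel

instance : IsProbabilityMeasure Z.measure := by unfold measure; infer_instance

theorem measure_map_fst : Z.measure.map Prod.fst = volume :=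
  Measure.fst_compProd _ _

theorem measure_map_snd : Z.measure.map Prod.snd = volume := by
  have : IsProbabilityMeasure (Z.measure.map Prod.snd) :=
    Measure.isProbabilityMeasure_map measurable_snd.aemeasurable
  refine ext_of_Iio fun y => ?_
  rw [Measure.map_apply measurable_snd measurableSet_Iio, ← univ_prod, measure,
    Measure.compProd_apply_prod .univ measurableSet_Iio, Measure.restrict_univ,
    unitInterval.volume_Iio]
  have : ∫⁻ x, Z.kernel x (Iio y) = ∫⁻ x, ENNReal.ofReal (Z.toFun x y) := by
    refine lintegral_congr_ae ?_
    filter_upwards [Z.kernel_ae_eq] with x hx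
    rw [hx, cdfMeasure_Iio (Z.isCdf x)]
  rw [this, ← ofReal_integral_eq_lintegral_ofReal, Z.integral_eq]
  · refine Integrable.of_bound (C := 1) (Z.aemeasurable_section y).aestronglyMeasurable
      (ae_of_all _ fun x => ?_)
    rw [Real.norm_eq_abs, abs_of_nonneg (Z.toFun x y).2.1]
    exact (Z.toFun x y).2.2
  · exact ae_of_all _ fun x => (Z.toFun x y).2.1

theorem nearPermuton : NearPermuton 0 Z.measure :=
  ⟨Z.measure_map_fst ▸ nearUniform_volume, Z.measure_map_snd ▸ nearUniform_volume⟩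

theorem setIntegral_cdfMeasure_real (x₁ x₂ y₁ y₂ : I) :
    ∫ x in Icc x₁ x₂, (cdfMeasure (Z.toFun x)).real (Icc y₁ y₂) =
      Z.measure.real (rect ((x₁, x₂), (y₁, y₂))) := by
  rw [Measure.real, rect, measure, Measure.compProd_apply_prod measurableSet_Icc measurableSet_Icc,
    ← integral_toReal]
  · refine setIntegral_congr_ae measurableSet_Icc ?_
    filter_upwards [Z.kernel_ae_eq] with x hx _
    rw [hx]; rfl
  · exact (Z.kernel.measurable_coe measurableSet_Icc).aemeasurable
  · exact ae_of_all _ fun x => measure_lt_top _ _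

end LimitPermutation

/-- A set of full measure is dense, hence accumulates at every `y ≠ 0` from the left, where left
continuity applies. -/
theorem cdf_eq_of_ae_eq {F G : I → I} (hF : IsCdf F) (hG : IsCdf G) (h : ∀ᵐ y, F y = G y) :
    F = G := by
  have hD : Dense {y | F y = G y} := by
    refine dense_iff_inter_open.2 fun U hU hne => ?_
    obtain ⟨a, b, hab, hsub⟩ : ∃ a b : I, a < b ∧ Icc a b ⊆ U := by
      obtain ⟨x, hx⟩ := hne
      obtain ⟨r, hr, hball⟩ := Metric.isOpen_iff.1 hU x hx
      have hoc : (Metric.ball x r).OrdConnected := by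
        have : Metric.ball x r = Subtype.val ⁻¹' Metric.ball (x : ℝ) r := rfl
        rw [this, Real.ball_eq_Ioo]
        exact ordConnected_Ioo.preimage_mono (Subtype.mono_coe _)
      obtain ⟨a, b, hab, -, h2⟩ := exists_Icc_of_isCompact_subset Metric.isOpen_ball hoc
        ⟨x, Metric.mem_ball_self hr⟩ isCompact_empty (empty_subset _)
      exact ⟨a, b, hab, h2.trans hball⟩
    by_contra hemp
    have h1 : Icc a b ⊆ {y | F y = G y}ᶜ := fun y hy hy' => hemp ⟨y, hsub hy, hy'⟩
    have h2 := measure_mono_null h1 h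
    rw [unitInterval.volume_Icc, ENNReal.ofReal_eq_zero, sub_nonpos] at h2
    exact absurd hab (not_lt.2 h2)
  funext y
  by_cases hy : y = 0
  · rw [hy, hF.map_zero, hG.map_zero]
  have hcl : y ∈ closure (Iio y ∩ {y | F y = G y}) := by
    refine closure_minimal (hD.open_subset_closure_inter isOpen_Iio) isClosed_closure ?_
    rw [closure_Iio' (⟨0, unitInterval.pos_iff_ne_zero.2 hy⟩ : (Iio y).Nonempty)]
    exact self_mem_Iic
  have := mem_closure_iff_nhdsWithin_neBot.1 hcl
  have hle : 𝓝[Iio y ∩ {y | F y = G y}] y ≤ 𝓝[Iic y] y :=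
    nhdsWithin_mono _ (inter_subset_left.trans Iio_subset_Iic_self)
  refine tendsto_nhds_unique ((hF.left_cont y).mono_left hle)
    (((hG.left_cont y).mono_left hle).congr' ?_)
  filter_upwards [self_mem_nhdsWithin] with z hz
  exact hz.2.symm

theorem almostEqual_iff_ae {Z₁ Z₂ : LimitPermutation} :
    AlmostEqual Z₁ Z₂ ↔ ∀ᵐ x, Z₁.toFun x = Z₂.toFun x := by
  constructor
  · intro h
    have h1 : ∀ᵐ x, ∀ᵐ y, Z₁.toFun x y = Z₂.toFun x y :=
      Measure.ae_ae_of_ae_prod (p := fun p : I × I => Z₁.toFun p.1 p.2 = Z₂.toFun p.1 p.2) h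
    filter_upwards [h1] with x hx
    exact cdf_eq_of_ae_eq (Z₁.isCdf x) (Z₂.isCdf x) hx
  · intro h
    have : {p : I × I | Z₁.toFun p.1 p.2 ≠ Z₂.toFun p.1 p.2} ⊆
        {x | Z₁.toFun x ≠ Z₂.toFun x} ×ˢ univ :=
      fun p hp => ⟨fun e => hp (congrFun e _), trivial⟩
    refine measure_mono_null this ?_
    rw [Measure.volume_eq_prod, Measure.prod_prod]
    have h0 : volume {x | Z₁.toFun x ≠ Z₂.toFun x} = 0 := h
    rw [h0, zero_mul]

/-- Equality passes from closed rectangles to products of open order-convex sets, a generating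
π-system. Equal measures have almost everywhere equal conditional laws, and these determine the
cdfs. -/
theorem almostEqual_of_measure_rect_eq {Z₁ Z₂ : LimitPermutation}
    (h : ∀ x₁ x₂ y₁ y₂ : I, x₁ < x₂ → y₁ < y₂ → Z₁.measure.real (rect ((x₁, x₂), (y₁, y₂))) =
      Z₂.measure.real (rect ((x₁, x₂), (y₁, y₂)))) : AlmostEqual Z₁ Z₂ := by
  rw [almostEqual_iff_ae]
  let C : Set (Set I) := {A | IsOpen A ∧ A.OrdConnected}
  have hC : MeasurableSpace.generateFrom C = (inferInstance : MeasurableSpace I) := by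
    refine le_antisymm (MeasurableSpace.generateFrom_le fun A hA => hA.1.measurableSet) ?_
    refine ((BorelSpace.measurable_eq (α := I)).trans (borel_eq_generateFrom_Iio I)).le.trans ?_
    refine MeasurableSpace.generateFrom_mono ?_
    rintro _ ⟨a, rfl⟩
    exact ⟨isOpen_Iio, ordConnected_Iio⟩
  have hpi : IsPiSystem C := fun A hA B hB _ => ⟨hA.1.inter hB.1, hA.2.inter hB.2⟩
  have hspan : IsCountablySpanning C :=
    ⟨fun _ => univ, fun _ => ⟨isOpen_univ, ordConnected_univ⟩, iUnion_const _⟩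
  have heq : Z₁.measure = Z₂.measure := by
    refine ext_of_generate_finite _ (generateFrom_eq_prod hC hC hspan hspan).symm (hpi.prod hpi) ?_
      (by simp)
    rintro _ ⟨A, hA, B, hB, rfl⟩
    have := abs_measureReal_openRect_sub_le (D := 0) (fun x₁ x₂ y₁ y₂ hx hy =>
      (abs_nonpos_iff.2 (sub_eq_zero.2 (h x₁ x₂ y₁ y₂ hx hy)))) hA.1 hA.2 hB.1 hB.2
    exact (measureReal_eq_measureReal_iff).1 (sub_eq_zero.1 (abs_nonpos_iff.1 this))
  filter_upwards [Kernel.ae_eq_of_compProd_eq heq, Z₁.kernel_ae_eq, Z₂.kernel_ae_eq] with x h0 h1 h2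
  exact cdf_eq_of_cdfMeasure_eq (Z₁.isCdf x) (Z₂.isCdf x) (by rw [← h1, ← h2, h0])

/-! ### Pattern densities of limit permutations -/

theorem measurable_pi_kernel {m : ℕ} (κ : Kernel I I) [IsMarkovKernel κ] :
    Measurable fun x : Fin m → I => Measure.pi fun i => κ (x i) := by
  refine Measurable.measure_of_isPiSystem_of_isProbabilityMeasure generateFrom_pi.symm
    isPiSystem_pi ?_
  rintro _ ⟨s, hs, rfl⟩
  simp only [Measure.pi_pi]
  exact Finset.measurable_fun_prod _ fun i _ =>
    (κ.measurable_coe (hs i trivial)).comp (measurable_pi_apply i)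

/-- The kernel that draws the coordinates independently from `κ (x i)`. -/
def piKernel (m : ℕ) (κ : Kernel I I) [IsMarkovKernel κ] : Kernel (Fin m → I) (Fin m → I) :=
  ⟨fun x => Measure.pi fun i => κ (x i), measurable_pi_kernel κ⟩

instance (m : ℕ) (κ : Kernel I I) [IsMarkovKernel κ] : IsMarkovKernel (piKernel m κ) :=
  ⟨fun x => by change IsProbabilityMeasure (Measure.pi fun i => κ (x i)); infer_instance⟩

/-- Drawing `m` independent points amounts to drawing all first coordinates and then, independently,
the second coordinates from their conditional laws. Both laws factor in the same way on boxes. -/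
theorem pi_compProd (m : ℕ) (κ : Kernel I I) [IsMarkovKernel κ] :
    (Measure.pi fun _ : Fin m => (volume : Measure I) ⊗ₘ κ) =
      ((Measure.pi fun _ : Fin m => (volume : Measure I)) ⊗ₘ piKernel m κ).map
        fun q i => (q.1 i, q.2 i) := by
  have hm : Measurable fun (q : (Fin m → I) × (Fin m → I)) (i : Fin m) => (q.1 i, q.2 i) := by
    fun_prop
  refine Measure.pi_eq (μ := fun _ : Fin m => (volume : Measure I) ⊗ₘ κ) fun s hs => ?_
  rw [Measure.map_apply hm (.univ_pi hs), Measure.compProd_apply (hm (.univ_pi hs))]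
  have h1 : ∀ x : Fin m → I, piKernel m κ x (Prod.mk x ⁻¹'
      ((fun (q : (Fin m → I) × (Fin m → I)) (i : Fin m) => (q.1 i, q.2 i)) ⁻¹' Set.pi univ s)) =
      ∏ i, κ (x i) (Prod.mk (x i) ⁻¹' s i) := by
    intro x
    exact Measure.pi_pi (fun i => κ (x i)) fun i => Prod.mk (x i) ⁻¹' s i
  simp only [h1]
  have hk : ∀ i, Measurable fun t => κ t (Prod.mk t ⁻¹' s i) :=
    fun i => Kernel.measurable_kernel_prodMk_left (hs i)
  rw [lintegral_prod_eq_prod_lintegral_of_indepFun Finset.univ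
    (fun i (x : Fin m → I) => κ (x i) (Prod.mk (x i) ⁻¹' s i))
    (iIndepFun_pi fun i => (hk i).aemeasurable) (fun i => (hk i).comp (measurable_pi_apply i))]
  refine Finset.prod_congr rfl fun i _ => ?_
  rw [Measure.compProd_apply (hs i)]
  exact (measurePreserving_eval (fun _ : Fin m => (volume : Measure I)) i).lintegral_comp (hk i)

/-- The core lists the measures by rank in the second coordinate; reindexing by `τ⁻¹` lists them by
position instead. -/
theorem core_eq {τ : FinPerm} {Z : I → I → I} {κ : Kernel I I} [IsMarkovKernel κ]
    {x : Fin τ.1 → I} (h : ∀ i, κ (x i) = cdfMeasure (Z (x i))) :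
    core τ Z x = (piKernel τ.1 κ x).real {y | StrictMono fun i => y (τ.2⁻¹ i)} := by
  have hp := measurePreserving_piCongrLeft (fun i => κ (x i)) τ.2⁻¹
  have h2 := hp.symm.measureReal_preimage
    (s := {y : Fin τ.1 → I | StrictMono y})
    (measurableSet_strictMono fun i => measurable_pi_apply i).nullMeasurableSet
  simp only [core, ← h]
  rw [← h2]
  rfl

theorem limitDensity_eq (τ : FinPerm) (Z : LimitPermutation) :
    limitDensity τ Z.toFun = τ.length.factorial * patternMass τ.2 Z.measure := by
  rw [limitDensity]
  congr 1
  have hS : MeasurableSet {y : Fin τ.1 → I | StrictMono fun i => y (τ.2⁻¹ i)} :=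
    measurableSet_strictMono fun i => measurable_pi_apply _
  have hX : MeasurableSet {x : Fin τ.1 → I | StrictMono x} :=
    measurableSet_strictMono fun i => measurable_pi_apply _
  have hae : ∀ᵐ x : Fin τ.1 → I, ∀ i, Z.kernel (x i) = cdfMeasure (Z.toFun (x i)) := by
    rw [eventually_countable_forall]
    exact fun i => (Measure.quasiMeasurePreserving_eval (fun _ : Fin τ.1 => (volume : Measure I)) i).ae
      Z.kernel_ae_eq
  have h1 : ∫ x in {x : Fin τ.1 → I | StrictMono x}, core τ Z.toFun x =
      ∫ x in {x : Fin τ.1 → I | StrictMono x},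
        (piKernel τ.1 Z.kernel x).real {y | StrictMono fun i => y (τ.2⁻¹ i)} := by
    refine setIntegral_congr_ae hX ?_
    filter_upwards [hae] with x hx _
    exact core_eq hx
  rw [h1, patternMass, LimitPermutation.measure, pi_compProd, Measure.real, Measure.map_apply
    (by fun_prop) (measurableSet_sortedBy _ _)]
  have h2 : (fun (q : (Fin τ.1 → I) × (Fin τ.1 → I)) (i : Fin τ.1) => (q.1 i, q.2 i)) ⁻¹'
      sortedBy 1 τ.2⁻¹ = {x | StrictMono x} ×ˢ {y | StrictMono fun i => y (τ.2⁻¹ i)} := rfl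
  rw [h2, Measure.compProd_apply_prod hX hS]
  exact integral_toReal ((piKernel τ.1 Z.kernel).measurable_coe hS).aemeasurable
    (ae_of_all _ fun x => measure_lt_top _ _)

/-! ### The measure of a finite permutation -/

/-- The point `(i + 1) / n`, the right endpoint of the cell with index `i`. -/
def gridPoint (n : ℕ+) (i : Fin n) : I :=
  ⟨((i : ℕ) + 1 : ℝ) / n, by positivity, by
    rw [div_le_one (by exact_mod_cast n.pos)]
    exact_mod_cast i.2⟩

/-- The point `i / n`, the left endpoint of the cell with index `i`. -/
def leftGridPoint (n : ℕ+) (i : Fin n) : I :=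
  ⟨(i : ℕ) / n, by positivity, by
    rw [div_le_one (by exact_mod_cast n.pos)]
    exact_mod_cast i.2.le⟩

theorem strictMono_gridPoint (n : ℕ+) : StrictMono (gridPoint n) := by
  intro i j hij
  have hn : (0 : ℝ) < n := by exact_mod_cast n.pos
  have h : (i : ℝ) < j := by exact_mod_cast hij
  change ((i : ℕ) + 1 : ℝ) / n < ((j : ℕ) + 1 : ℝ) / n
  gcongr

theorem monotone_cell (n : ℕ+) : Monotone (cell n) := by
  intro x y hxy
  have h : ⌈(n : ℝ) * (x : ℝ)⌉₊ ≤ ⌈(n : ℝ) * (y : ℝ)⌉₊ :=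
    Nat.ceil_mono (mul_le_mul_of_nonneg_left hxy (Nat.cast_nonneg _))
  exact Fin.mk_le_mk.2 (Nat.sub_le_sub_right h 1)

theorem measurable_cell (n : ℕ+) : Measurable (cell n) := by
  refine measurable_to_countable' fun i => ?_
  have h : Measurable fun x : I => ⌈(n : ℝ) * (x : ℝ)⌉₊ - 1 := by fun_prop
  convert h (measurableSet_singleton (i : ℕ)) using 1
  ext x
  simp [cell, Fin.ext_iff]

theorem mem_Icc_cell (n : ℕ+) (x : I) : x ∈ Icc (leftGridPoint n (cell n x)) (gridPoint n (cell n x)) := by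
  have hn : (0 : ℝ) < n := by exact_mod_cast n.pos
  have h1 := Nat.le_ceil ((n : ℝ) * (x : ℝ))
  have h2 := Nat.ceil_lt_add_one (mul_nonneg hn.le x.2.1)
  constructor
  · change ((⌈(n : ℝ) * (x : ℝ)⌉₊ - 1 : ℕ) : ℝ) / n ≤ x
    rw [div_le_iff₀ hn]
    -- At `x = 0` the ceiling is `0` and the truncated subtraction puts `x` into the first cell.
    rcases Nat.eq_zero_or_pos ⌈(n : ℝ) * (x : ℝ)⌉₊ with h | h
    · rw [h]
      simpa using mul_nonneg x.2.1 hn.le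
    · rw [Nat.cast_sub h]
      push_cast
      linarith
  · change (x : ℝ) ≤ (((⌈(n : ℝ) * (x : ℝ)⌉₊ - 1 : ℕ) : ℝ) + 1) / n
    rw [le_div_iff₀ hn]
    have : ⌈(n : ℝ) * (x : ℝ)⌉₊ ≤ (⌈(n : ℝ) * (x : ℝ)⌉₊ - 1) + 1 := by omega
    have : (⌈(n : ℝ) * (x : ℝ)⌉₊ : ℝ) ≤ ((⌈(n : ℝ) * (x : ℝ)⌉₊ - 1 : ℕ) : ℝ) + 1 := by
      exact_mod_cast this
    linarith

theorem Ioc_subset_cell (n : ℕ+) (i : Fin n) :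
    Ioc (leftGridPoint n i) (gridPoint n i) ⊆ cell n ⁻¹' {i} := by
  have hn : (0 : ℝ) < n := by exact_mod_cast n.pos
  rintro x ⟨h1, h2⟩
  have h1' : ((i : ℕ) : ℝ) / n < x := h1
  have h2' : (x : ℝ) ≤ ((i : ℕ) + 1) / n := h2
  rw [div_lt_iff₀ hn] at h1'
  rw [le_div_iff₀ hn] at h2'
  have : ⌈(n : ℝ) * (x : ℝ)⌉₊ = (i : ℕ) + 1 := by
    rw [Nat.ceil_eq_iff (by omega)]
    constructor
    · simp only [Nat.add_sub_cancel]; linarith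
    · push_cast; linarith
  refine Fin.ext ?_
  change ⌈(n : ℝ) * (x : ℝ)⌉₊ - 1 = i
  omega

theorem gridPoint_sub_leftGridPoint (n : ℕ+) (i : Fin n) :
    (gridPoint n i : ℝ) - leftGridPoint n i = 1 / n := by
  change ((i : ℕ) + 1 : ℝ) / n - ((i : ℕ) : ℝ) / n = 1 / n
  ring

theorem volume_cell (n : ℕ+) (i : Fin n) : volume (cell n ⁻¹' {i}) = ENNReal.ofReal (1 / n) := by
  refine le_antisymm ?_ ?_
  · have h : cell n ⁻¹' {i} ⊆ Icc (leftGridPoint n i) (gridPoint n i) := by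
      rintro x rfl
      exact mem_Icc_cell n x
    refine (measure_mono h).trans_eq ?_
    rw [unitInterval.volume_Icc, gridPoint_sub_leftGridPoint]
  · refine le_trans (le_of_eq ?_) (measure_mono (Ioc_subset_cell n i))
    rw [unitInterval.volume_Ioc, gridPoint_sub_leftGridPoint]

theorem map_cell_singleton (n : ℕ+) (i : Fin n) :
    (volume : Measure I).map (cell n) {i} = ENNReal.ofReal (1 / n) := by
  rw [Measure.map_apply (measurable_cell n) (measurableSet_singleton i), volume_cell]

theorem map_perm_cell (n : ℕ+) (p : Equiv.Perm (Fin n)) :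
    (volume : Measure I).map (fun x => p (cell n x)) = (volume : Measure I).map (cell n) := by
  have : (volume : Measure I).map (fun x => p (cell n x)) = ((volume : Measure I).map (cell n)).map p :=
    (Measure.map_map (measurable_of_countable p) (measurable_cell n)).symm
  rw [this]
  refine Measure.ext_of_singleton fun i => ?_
  have hp : p ⁻¹' {i} = {p.symm i} := by
    ext j
    simp [Equiv.eq_symm_apply]
  rw [Measure.map_apply (measurable_of_countable p) (measurableSet_singleton i), hp,
    map_cell_singleton, map_cell_singleton]

/-- The height over `x` of the graph of a permutation, rescaled to the unit square. -/
def height (π : FinPerm) (x : I) : I := gridPoint π.1 (π.2 (cell π.1 x))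

theorem measurable_height (π : FinPerm) : Measurable (height π) :=
  (measurable_of_countable fun i => gridPoint π.1 (π.2 i)).comp (measurable_cell π.1)

/-- The measure on the unit square carried by the rescaled graph of a permutation. -/
def stepMeasure (π : FinPerm) : Measure (I × I) := volume.map fun x => (x, height π x)

theorem measurable_graph (π : FinPerm) : Measurable fun x => (x, height π x) :=
  measurable_id.prodMk (measurable_height π)

instance (π : FinPerm) : IsProbabilityMeasure (stepMeasure π) :=
  Measure.isProbabilityMeasure_map (measurable_graph π).aemeasurable

theorem stepMeasure_map_fst (π : FinPerm) : (stepMeasure π).map Prod.fst = volume := by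
  rw [stepMeasure, Measure.map_map measurable_fst (measurable_graph π)]
  exact Measure.map_id

theorem stepMeasure_map_snd (π : FinPerm) :
    (stepMeasure π).map Prod.snd = volume.map fun x => gridPoint π.1 (cell π.1 x) := by
  rw [stepMeasure, Measure.map_map measurable_snd (measurable_graph π)]
  have h := measurable_of_countable (gridPoint π.1)
  have h1 : (volume : Measure I).map (fun x => gridPoint π.1 (cell π.1 x)) =
      ((volume : Measure I).map (cell π.1)).map (gridPoint π.1) :=
    (Measure.map_map h (measurable_cell _)).symm
  have hp : Measurable fun x => π.2 (cell π.1 x) :=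
    (measurable_of_countable π.2).comp (measurable_cell _)
  rw [h1, ← map_perm_cell π.1 π.2, Measure.map_map h hp]
  rfl

theorem nearPermuton_stepMeasure (π : FinPerm) : NearPermuton (1 / π.length) (stepMeasure π) := by
  have hε : (0 : ℝ) ≤ 1 / π.length := by positivity
  constructor
  · rw [stepMeasure_map_fst]
    refine ⟨inferInstance, fun a b hab => ?_⟩
    have := nearUniform_volume.Icc_le a b hab
    linarith
  · rw [stepMeasure_map_snd]
    have hm : Measurable fun x => gridPoint π.1 (cell π.1 x) :=
      (measurable_of_countable (gridPoint π.1)).comp (measurable_cell _)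
    refine ⟨Measure.isProbabilityMeasure_map hm.aemeasurable, fun a b hab => ?_⟩
    rw [map_measureReal_apply hm measurableSet_Icc]
    have ha0 := a.2.1
    have ha1 := a.2.2
    have hab' : (a : ℝ) ≤ b := hab
    -- The second marginal is the law of `x` moved up to the right end of its cell, by at most `1 /
    -- n`; hence the interval is widened by `1 / n` to the left and clipped at `0`.
    let a' : I := ⟨max 0 (a - 1 / π.length), le_max_left _ _, max_le zero_le_one (by linarith)⟩
    have hab'' : a' ≤ b := by
      change max 0 ((a : ℝ) - 1 / π.length) ≤ b
      exact max_le b.2.1 (by linarith)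
    have hsub : (fun x => gridPoint π.1 (cell π.1 x)) ⁻¹' Icc a b ⊆ Icc a' b := by
      rintro x ⟨h1, h2⟩
      have hx := mem_Icc_cell π.1 x
      refine ⟨?_, hx.2.trans h2⟩
      change max 0 ((a : ℝ) - 1 / π.length) ≤ x
      have h1' : (a : ℝ) ≤ gridPoint π.1 (cell π.1 x) := h1
      have h3 : (leftGridPoint π.1 (cell π.1 x) : ℝ) ≤ x := hx.1
      have h4 := gridPoint_sub_leftGridPoint π.1 (cell π.1 x)
      refine max_le x.2.1 ?_
      change (a : ℝ) - 1 / ((π.1 : ℕ) : ℝ) ≤ x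
      linarith
    have h5 := (measureReal_mono (μ := volume) hsub).trans (nearUniform_volume.Icc_le a' b hab'')
    have h6 : (a : ℝ) - 1 / π.length ≤ a' := le_max_right _ _
    linarith

/-- The strict inequality between cells says that `y` lies beyond the right end of the cell of value
`π ⌈n x⌉`; this is why `height` uses right endpoints. -/
theorem stepFunction_eq (π : FinPerm) {x : I} (hx : x ≠ 0) (y : I) :
    stepFunction π x y = if y ≤ height π x then 0 else 1 := by
  have hn : (0 : ℝ) < π.1 := by exact_mod_cast π.1.pos
  set s := π.2 (cell π.1 x) with hs
  by_cases hy : y = 0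
  · rw [stepFunction, if_pos hy, if_pos (hy ▸ unitInterval.nonneg')]
  have h : s < cell π.1 y ↔ ¬ y ≤ height π x := by
    rw [not_le]
    have h1 : height π x < y ↔ ((s : ℕ) + 1 : ℝ) / π.1 < y := Iff.rfl
    have h2 : s < cell π.1 y ↔ (s : ℕ) < ⌈(π.1 : ℝ) * (y : ℝ)⌉₊ - 1 := Iff.rfl
    rw [h1, h2, div_lt_iff₀ hn, Nat.lt_sub_iff_add_lt, Nat.lt_ceil, mul_comm]
    push_cast
    rfl
  rw [stepFunction, if_neg hy, if_neg hx, ← hs, if_congr h rfl rfl, ite_not]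

theorem isCdf_stepFunction (π : FinPerm) {x : I} (hx : x ≠ 0) : IsCdf (stepFunction π x) := by
  have he : stepFunction π x = fun y => if y ≤ height π x then 0 else 1 :=
    funext (stepFunction_eq π hx)
  rw [he]
  refine ⟨fun a b hab => ?_, fun y => ?_, if_pos unitInterval.nonneg'⟩
  · by_cases h1 : b ≤ height π x
    · simp [h1, hab.trans h1]
    · simpa [h1] using unitInterval.le_one'
  · by_cases hy : y ≤ height π x
    · refine (continuousWithinAt_const (b := (0 : I))).congr (fun z hz => ?_) ?_
      · exact if_pos (le_trans hz hy)
      · exact if_pos hy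
    · refine (continuousAt_const (y := (1 : I))).continuousWithinAt.congr_of_eventuallyEq ?_ ?_
      · filter_upwards [mem_nhdsWithin_of_mem_nhds (Ioi_mem_nhds (not_le.1 hy))] with z hz
        exact if_neg (not_le.2 hz)
      · exact if_neg hy

theorem cdfMeasure_stepFunction (π : FinPerm) {x : I} (hx : x ≠ 0) :
    cdfMeasure (stepFunction π x) = Measure.dirac (height π x) := by
  have := isProbabilityMeasure_cdfMeasure (isCdf_stepFunction π hx)
  refine ext_of_Iio fun y => ?_
  rw [cdfMeasure_Iio (isCdf_stepFunction π hx), stepFunction_eq π hx,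
    Measure.dirac_apply' _ measurableSet_Iio]
  by_cases hy : y ≤ height π x
  · simp [hy, indicator]
  · simp [hy, indicator, not_le.1 hy]

theorem setIntegral_cdfMeasure_stepFunction (π : FinPerm) (x₁ x₂ y₁ y₂ : I) :
    ∫ x in Icc x₁ x₂, (cdfMeasure (stepFunction π x)).real (Icc y₁ y₂) =
      (stepMeasure π).real (rect ((x₁, x₂), (y₁, y₂))) := by
  have hB := measurable_height π (measurableSet_Icc (a := y₁) (b := y₂))
  have h0 : ∀ᵐ x : I, x ≠ 0 := measure_eq_zero_iff_ae_notMem.1 (measure_singleton (0 : I))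
  have h1 : ∫ x in Icc x₁ x₂, (cdfMeasure (stepFunction π x)).real (Icc y₁ y₂) =
      ∫ x in Icc x₁ x₂, (height π ⁻¹' Icc y₁ y₂).indicator 1 x := by
    refine setIntegral_congr_ae measurableSet_Icc ?_
    filter_upwards [h0] with x hx _
    rw [cdfMeasure_stepFunction π hx, Measure.real, Measure.dirac_apply' _ measurableSet_Icc]
    by_cases h : height π x ∈ Icc y₁ y₂
    · rw [indicator_of_mem h, indicator_of_mem (by exact h)]; simp
    · rw [indicator_of_notMem h, indicator_of_notMem (by exact h)]; simp
  rw [h1, integral_indicator_one hB, stepMeasure, map_measureReal_apply (measurable_graph π)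
    (measurableSet_rect _), measureReal_restrict_apply hB, inter_comm]
  rfl

/-- The pattern probabilities of the measure of `π` count the occurrences in `π`. -/
theorem patternMass_stepMeasure (τ π : FinPerm) :
    patternMass τ.2 (stepMeasure π) = occurrences τ π / (π.length : ℝ) ^ τ.length := by
  let O : Set (Fin τ.1 → Fin π.1) :=
    {x | StrictMono x ∧ ∀ i j, π.2 (x i) < π.2 (x j) ↔ τ.2 i < τ.2 j}
  have hcellm : Measurable fun (X : Fin τ.1 → I) i => cell π.1 (X i) :=
    measurable_pi_lambda _ fun i => (measurable_cell _).comp (measurable_pi_apply i)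
  have hgraphm : Measurable fun (X : Fin τ.1 → I) i => (X i, height π (X i)) :=
    measurable_pi_lambda _ fun i => (measurable_graph π).comp (measurable_pi_apply i)
  have hpre : (fun (X : Fin τ.1 → I) i => (X i, height π (X i))) ⁻¹' sortedBy 1 τ.2⁻¹ =
      (fun X i => cell π.1 (X i)) ⁻¹' O := by
    ext X
    have hy : StrictMono (fun i => height π (X (τ.2⁻¹ i))) ↔
        ∀ i j, π.2 (cell π.1 (X i)) < π.2 (cell π.1 (X j)) ↔ τ.2 i < τ.2 j := by
      constructor
      · intro h i j
        have := h.lt_iff_lt (a := τ.2 i) (b := τ.2 j)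
        simp only [height, (strictMono_gridPoint _).lt_iff_lt] at this
        simpa using this
      · intro h i j hij
        refine strictMono_gridPoint _ ((h _ _).2 ?_)
        simpa using hij
    simp only [mem_preimage, sortedBy, mem_ofPred_eq, hy, O]
    -- The pattern condition on values forces distinct cells, and for points in distinct cells
    -- sorting the points is the same as sorting the cells.
    refine and_congr_left fun h => ?_
    have hinj : Function.Injective fun i => cell π.1 (X i) := by
      intro i j hij
      have hij' : cell π.1 (X i) = cell π.1 (X j) := hij
      have h1 := h i j
      have h2 := h j i
      rw [hij'] at h1 h2
      simp only [lt_self_iff_false, false_iff, not_lt] at h1 h2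
      exact τ.2.injective (le_antisymm h2 h1)
    constructor
    · intro hX
      exact ((monotone_cell _).comp (StrictMono.monotone hX)).strictMono_of_injective hinj
    · intro hX i j hij
      by_contra hle
      exact absurd (hX hij) (not_lt.2 (monotone_cell _ (not_lt.1 hle)))
  have h1 : (Measure.pi fun _ : Fin τ.1 => stepMeasure π) =
      (Measure.pi fun _ : Fin τ.1 => (volume : Measure I)).map fun X i => (X i, height π (X i)) := by
    have : ∀ i : Fin τ.1, IsProbabilityMeasure ((volume : Measure I).map fun x => (x, height π x)) :=
      fun _ => Measure.isProbabilityMeasure_map (measurable_graph π).aemeasurable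
    exact (Measure.pi_map_pi fun _ => (measurable_graph π).aemeasurable).symm
  have h2 : (Measure.pi fun _ : Fin τ.1 => (volume : Measure I).map (cell π.1)) =
      (Measure.pi fun _ : Fin τ.1 => (volume : Measure I)).map fun X i => cell π.1 (X i) := by
    have : ∀ i : Fin τ.1, IsProbabilityMeasure ((volume : Measure I).map (cell π.1)) :=
      fun _ => Measure.isProbabilityMeasure_map (measurable_cell _).aemeasurable
    exact (Measure.pi_map_pi fun _ => (measurable_cell _).aemeasurable).symm
  have hcell : IsProbabilityMeasure ((volume : Measure I).map (cell π.1)) :=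
    Measure.isProbabilityMeasure_map (measurable_cell _).aemeasurable
  have hO : MeasurableSet O := O.toFinite.measurableSet
  rw [patternMass, h1, map_measureReal_apply hgraphm (measurableSet_sortedBy _ _), hpre,
    ← map_measureReal_apply hcellm hO, ← h2]
  -- The cells are independent and uniform, so every tuple of cells is equally likely.
  have h3 : ∀ x : Fin τ.1 → Fin π.1, (Measure.pi fun _ : Fin τ.1 => (volume : Measure I).map
      (cell π.1)).real {x} = (1 / (π.length : ℝ)) ^ τ.length := by
    intro x
    rw [Measure.real, Measure.pi_singleton]
    simp only [map_cell_singleton, ENNReal.toReal_prod]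
    rw [Finset.prod_const, ENNReal.toReal_ofReal (by positivity)]
    simp [FinPerm.length]
  have h4 : occurrences τ π = (O.toFinite.toFinset).card := Set.ncard_eq_toFinset_card O O.toFinite
  rw [h4, ← O.toFinite.coe_toFinset, ← sum_measureReal_singleton]
  simp only [h3, Finset.sum_const, nsmul_eq_mul, one_div_pow, mul_one_div, Finite.coe_toFinset]

/-- The largest value of the permutation is placed at height exactly `1`, so the top edge carries
mass `1 / n`. -/
theorem one_div_le_measureReal_rect (π : FinPerm) (a : I) :
    1 / (π.length : ℝ) ≤ (stepMeasure π).real (rect ((0, 1), (a, 1))) := by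
  have hm : Measurable fun x => gridPoint π.1 (cell π.1 x) :=
    (measurable_of_countable (gridPoint π.1)).comp (measurable_cell _)
  have hrect : rect ((0, 1), (a, 1)) = Prod.snd ⁻¹' Icc a 1 := by
    ext ⟨x, y⟩
    simp [rect, unitInterval.le_one']
  rw [hrect, ← map_measureReal_apply measurable_snd measurableSet_Icc, stepMeasure_map_snd,
    map_measureReal_apply hm measurableSet_Icc]
  let i : Fin π.1 := ⟨π.1 - 1, by have := π.1.pos; omega⟩
  have hi : gridPoint π.1 i = 1 := by
    refine Subtype.ext ?_
    have h1 : (((π.1 : ℕ) - 1 : ℕ) : ℝ) + 1 = (π.1 : ℕ) := by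
      exact_mod_cast Nat.sub_add_cancel π.1.pos
    change ((((π.1 : ℕ) - 1 : ℕ) : ℝ) + 1) / (π.1 : ℕ) = 1
    rw [h1, div_self (by exact_mod_cast π.1.ne_zero)]
  have hv : volume.real (cell π.1 ⁻¹' {i}) = 1 / (π.length : ℝ) := by
    rw [Measure.real, volume_cell, ENNReal.toReal_ofReal (by positivity)]
    rfl
  rw [← hv]
  refine measureReal_mono ?_
  intro x hx
  have hx' : cell π.1 x = i := hx
  rw [mem_preimage, hx', hi]
  exact ⟨unitInterval.le_one', le_rfl⟩

/-! ### The rectangular distance -/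

/-- The measure `ν` gives to closed rectangles the masses that enter the rectangular distance. -/
def Represents (W : I → I → I) (ν : Measure (I × I)) : Prop :=
  ∀ x₁ x₂ y₁ y₂ : I, ∫ x in Icc x₁ x₂, (cdfMeasure (W x)).real (Icc y₁ y₂) =
    ν.real (rect ((x₁, x₂), (y₁, y₂)))

theorem LimitPermutation.represents (Z : LimitPermutation) : Represents Z.toFun Z.measure :=
  Z.setIntegral_cdfMeasure_real

theorem represents_stepFunction (π : FinPerm) : Represents (stepFunction π) (stepMeasure π) :=
  setIntegral_cdfMeasure_stepFunction π

theorem rectDist_le {W₁ W₂ : I → I → I} {ν₁ ν₂ : Measure (I × I)} (h₁ : Represents W₁ ν₁)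
    (h₂ : Represents W₂ ν₂) {D : ℝ} (h : ∀ x₁ x₂ y₁ y₂ : I, x₁ < x₂ → y₁ < y₂ →
      |ν₁.real (rect ((x₁, x₂), (y₁, y₂))) - ν₂.real (rect ((x₁, x₂), (y₁, y₂)))| ≤ D) :
    rectDist W₁ W₂ ≤ D := by
  refine csSup_le ⟨_, 0, 1, 0, 1, zero_lt_one, zero_lt_one, rfl⟩ ?_
  rintro _ ⟨x₁, x₂, y₁, y₂, hx, hy, rfl⟩
  rw [h₁, h₂]
  exact h x₁ x₂ y₁ y₂ hx hy

theorem abs_sub_le_rectDist {W₁ W₂ : I → I → I} {ν₁ ν₂ : Measure (I × I)}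
    [IsProbabilityMeasure ν₁] [IsProbabilityMeasure ν₂] (h₁ : Represents W₁ ν₁)
    (h₂ : Represents W₂ ν₂) {x₁ x₂ y₁ y₂ : I} (hx : x₁ < x₂) (hy : y₁ < y₂) :
    |ν₁.real (rect ((x₁, x₂), (y₁, y₂))) - ν₂.real (rect ((x₁, x₂), (y₁, y₂)))|
      ≤ rectDist W₁ W₂ := by
  refine le_csSup ⟨1, ?_⟩ ⟨x₁, x₂, y₁, y₂, hx, hy, by rw [h₁, h₂]⟩
  rintro _ ⟨x₁, x₂, y₁, y₂, -, -, rfl⟩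
  rw [h₁, h₂]
  exact abs_sub_le_of_nonneg_of_le measureReal_nonneg measureReal_le_one measureReal_nonneg
    measureReal_le_one

theorem rectDist_eq_zero_iff (Z₁ Z₂ : LimitPermutation) :
    rectDist Z₁.toFun Z₂.toFun = 0 ↔ AlmostEqual Z₁ Z₂ := by
  constructor
  · intro h
    refine almostEqual_of_measure_rect_eq fun x₁ x₂ y₁ y₂ hx hy => ?_
    have := abs_sub_le_rectDist Z₁.represents Z₂.represents hx hy
    rw [h] at this
    exact sub_eq_zero.1 (abs_nonpos_iff.1 this)
  · intro h
    have hae := almostEqual_iff_ae.1 h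
    have key : ∀ x₁ x₂ y₁ y₂ : I, Z₁.measure.real (rect ((x₁, x₂), (y₁, y₂))) =
        Z₂.measure.real (rect ((x₁, x₂), (y₁, y₂))) := by
      intro x₁ x₂ y₁ y₂
      rw [← Z₁.represents, ← Z₂.represents]
      refine setIntegral_congr_ae measurableSet_Icc ?_
      filter_upwards [hae] with x hx _
      rw [hx]
    refine le_antisymm (rectDist_le Z₁.represents Z₂.represents fun x₁ x₂ y₁ y₂ _ _ => ?_)
      ((abs_nonneg _).trans (abs_sub_le_rectDist Z₁.represents Z₂.represents
        (zero_lt_one (α := I)) (zero_lt_one (α := I))))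
    rw [key, sub_self, abs_zero]

theorem one_div_length_le_rectDist (π : FinPerm) (Z : LimitPermutation) :
    1 / (π.length : ℝ) ≤ rectDist (stepFunction π) Z.toFun := by
  refine le_of_forall_pos_le_add fun δ hδ => ?_
  -- The strip of height at most `δ` below the top edge has mass at most `δ` for `Z`, but at least
  -- `1 / n` for the permutation.
  let a : I := ⟨max 0 (1 - δ), le_max_left _ _, max_le zero_le_one (by linarith)⟩
  have ha : a < 1 := Subtype.mk_lt_mk.2 (max_lt zero_lt_one (by linarith))
  have h1 := abs_sub_le_rectDist (represents_stepFunction π) Z.represents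
    (zero_lt_one (α := I)) ha
  have h2 := one_div_le_measureReal_rect π a
  have h3 : Z.measure.real (rect ((0, 1), (a, 1))) ≤ δ := by
    have h4 := Z.nearPermuton.snd.Icc_le a 1 ha.le
    rw [map_measureReal_apply measurable_snd measurableSet_Icc] at h4
    have h5 : Z.measure.real (rect ((0, 1), (a, 1))) ≤ Z.measure.real (Prod.snd ⁻¹' Icc a 1) :=
      measureReal_mono fun z hz => hz.2
    have h6 : 1 - δ ≤ (a : ℝ) := le_max_right _ _
    simp only [Icc.coe_one] at h4
    linarith
  have h7 := (abs_le.1 h1).2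
  linarith

/-! ### Convergence of pattern densities -/

theorem occurrences_eq_zero {τ π : FinPerm} (h : π.length < τ.length) : occurrences τ π = 0 := by
  rw [occurrences, Set.ncard_eq_zero]
  refine eq_empty_of_forall_notMem fun x hx => ?_
  have := Fintype.card_le_of_injective x hx.1.injective
  simp only [Fintype.card_fin] at this
  exact absurd this (not_le.2 h)

/-- Sampling cells with replacement gives `n ^ m` tuples, whereas the density divides by `n.choose
m`; the last factor is the probability that `m` sampled cells are distinct. If `m > n` both sides
vanish. -/
theorem factorial_mul_patternMass (τ π : FinPerm) :
    τ.length.factorial * patternMass τ.2 (stepMeasure π) =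
      density τ π * ((π.length.descFactorial τ.length : ℝ) / (π.length : ℝ) ^ τ.length) := by
  rw [patternMass_stepMeasure, density]
  split_ifs with h
  · have hc : (π.length.choose τ.length : ℝ) ≠ 0 := by
      exact_mod_cast (Nat.choose_pos h).ne'
    rw [Nat.descFactorial_eq_factorial_mul_choose]
    push_cast
    field_simp
  · rw [occurrences_eq_zero (not_le.1 h)]
    simp

theorem tendsto_density_iff {π : ℕ → FinPerm} (hπ : Tendsto (fun n => (π n).length) atTop atTop)
    (τ : FinPerm) (Z : LimitPermutation) :
    Tendsto (fun n => density τ (π n)) atTop (𝓝 (limitDensity τ Z.toFun)) ↔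
      Tendsto (fun n => patternMass τ.2 (stepMeasure (π n))) atTop
        (𝓝 (patternMass τ.2 Z.measure)) := by
  have hr : Tendsto (fun n => (((π n).length.descFactorial τ.length : ℕ) : ℝ) /
      ((π n).length : ℝ) ^ τ.length) atTop (𝓝 1) := by
    have h := isEquivalent_descFactorial τ.length
    have h0 : ∀ᶠ n : ℕ in atTop, ((n : ℝ) ^ τ.length) ≠ 0 := by
      filter_upwards [eventually_gt_atTop 0] with n hn
      positivity
    exact ((Asymptotics.isEquivalent_iff_tendsto_one h0).1 h).comp hπ
  have hfac : (τ.length.factorial : ℝ) ≠ 0 := by positivity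
  rw [limitDensity_eq]
  constructor
  · intro h
    have h1 := (h.mul hr).const_mul (τ.length.factorial : ℝ)⁻¹
    simp only [← factorial_mul_patternMass, mul_one] at h1
    simpa only [inv_mul_cancel_left₀ hfac] using h1
  · intro h
    have h1 := (h.const_mul (τ.length.factorial : ℝ)).div hr one_ne_zero
    rw [div_one] at h1
    refine h1.congr' ?_
    filter_upwards [hr.eventually_ne one_ne_zero] with n hn
    rw [Pi.div_apply, factorial_mul_patternMass, mul_div_assoc, div_self hn, mul_one]

/-- In every length some pattern has positive density in a limit permutation. -/
theorem LimitPermutation.exists_patternMass_ne_zero (Z : LimitPermutation) (m : ℕ) :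
    ∃ τ : Equiv.Perm (Fin m), patternMass τ Z.measure ≠ 0 := by
  by_contra! h
  -- There are no ties almost surely, so the pattern probabilities over all pairs of sorting
  -- permutations sum to one.
  have := abs_measureReal_sub_sum_patternMass_le Z.nearPermuton (m := m) (E := univ)
    (G := Finset.univ) (by simp)
  simp [h] at this
  linarith

theorem ConvergesTo.tendsto_length {π : ℕ → FinPerm} {Z : LimitPermutation} (h : ConvergesTo π Z) :
    Tendsto (fun n => (π n).length) atTop atTop := by
  rw [tendsto_atTop]
  intro m
  obtain ⟨τ, hτ⟩ := Z.exists_patternMass_ne_zero (m + 1)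
  have hne : limitDensity ⟨m.succPNat, τ⟩ Z.toFun ≠ 0 := by
    rw [limitDensity_eq]
    exact mul_ne_zero (Nat.cast_ne_zero.2 (Nat.factorial_ne_zero _)) hτ
  filter_upwards [(h ⟨m.succPNat, τ⟩).eventually_ne hne] with n hn
  by_contra hlt
  -- A pattern longer than the permutation has density `0` by definition.
  refine hn (if_neg fun hle => ?_)
  have : m + 1 ≤ (π n).length := hle
  omega

theorem tendsto_length_of_tendsto_rectDist {π : ℕ → FinPerm} {Z : LimitPermutation}
    (h : Tendsto (fun n => rectDist (stepFunction (π n)) Z.toFun) atTop (𝓝 0)) :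
    Tendsto (fun n => (π n).length) atTop atTop := by
  have h1 : Tendsto (fun n => 1 / ((π n).length : ℝ)) atTop (𝓝 0) :=
    squeeze_zero (fun n => by positivity) (fun n => one_div_length_le_rectDist (π n) Z) h
  have hpos : ∀ n, 0 < (π n).length := fun n => (π n).1.pos
  rw [← tendsto_natCast_atTop_iff (R := ℝ)]
  have h2 : Tendsto (fun n => 1 / ((π n).length : ℝ)) atTop (𝓝[>] 0) :=
    tendsto_nhdsWithin_iff.2 ⟨h1, Eventually.of_forall fun n => by
      have : (0 : ℝ) < (π n).length := Nat.cast_pos.2 (hpos n)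
      exact one_div_pos.2 this⟩
  simpa [Function.comp_def] using tendsto_inv_nhdsGT_zero.comp h2

theorem convergesTo_iff_tendsto_rectDist (π : ℕ → FinPerm) (Z : LimitPermutation) :
    ConvergesTo π Z ↔ Tendsto (fun n => rectDist (stepFunction (π n)) Z.toFun) atTop (𝓝 0) := by
  constructor
  · intro h
    have hlen := h.tendsto_length
    have hε : Tendsto (fun n => 1 / ((π n).length : ℝ)) atTop (𝓝 0) :=
      tendsto_one_div_atTop_nhds_zero_nat.comp hlen
    have hu := tendstoUniformly_rect hε (fun n => nearPermuton_stepMeasure (π n)) Z.nearPermuton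
      (fun m τ => (tendsto_density_iff hlen ⟨m.succPNat, τ⟩ Z).1 (h _))
    rw [Metric.tendsto_nhds]
    intro δ hδ
    filter_upwards [Metric.tendstoUniformly_iff.1 hu (δ / 2) (by positivity)] with n hn
    have h1 : rectDist (stepFunction (π n)) Z.toFun ≤ δ / 2 := by
      refine rectDist_le (represents_stepFunction _) Z.represents fun x₁ x₂ y₁ y₂ _ _ => ?_
      have := hn ((x₁, x₂), (y₁, y₂))
      rw [dist_comm, Real.dist_eq] at this
      exact this.le
    have h2 : 0 ≤ rectDist (stepFunction (π n)) Z.toFun :=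
      le_trans (by positivity) (one_div_length_le_rectDist (π n) Z)
    rw [Real.dist_eq, sub_zero, abs_of_nonneg h2]
    linarith
  · intro h τ
    refine (tendsto_density_iff (tendsto_length_of_tendsto_rectDist h) τ Z).2 ?_
    rw [tendsto_iff_norm_sub_tendsto_zero]
    refine squeeze_zero (fun n => norm_nonneg _) (fun n => abs_patternMass_sub_le
      (fun x₁ x₂ y₁ y₂ hx hy => abs_sub_le_rectDist (represents_stepFunction (π n)) Z.represents
        hx hy) τ.2) ?_
    simpa using h.const_mul ((τ.1 : ℕ) : ℝ)

theorem ConvergesTo.almostEqual {π : ℕ → FinPerm} {Z₁ Z₂ : LimitPermutation}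
    (h₁ : ConvergesTo π Z₁) (h₂ : ConvergesTo π Z₂) : AlmostEqual Z₁ Z₂ := by
  rw [convergesTo_iff_tendsto_rectDist] at h₁ h₂
  refine almostEqual_of_measure_rect_eq fun x₁ x₂ y₁ y₂ hx hy => ?_
  have key : ∀ Z : LimitPermutation,
      Tendsto (fun n => rectDist (stepFunction (π n)) Z.toFun) atTop (𝓝 0) →
      Tendsto (fun n => (stepMeasure (π n)).real (rect ((x₁, x₂), (y₁, y₂)))) atTop
        (𝓝 (Z.measure.real (rect ((x₁, x₂), (y₁, y₂))))) := by
    intro Z hZ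
    rw [tendsto_iff_norm_sub_tendsto_zero]
    exact squeeze_zero (fun n => norm_nonneg _) (fun n => abs_sub_le_rectDist
      (represents_stepFunction (π n)) Z.represents hx hy) hZ
  exact tendsto_nhds_unique (key Z₁ h₁) (key Z₂ h₂)

theorem rectDist_congr_right {Z₁ Z₂ : LimitPermutation} (h : AlmostEqual Z₁ Z₂) (W : I → I → I) :
    rectDist W Z₁.toFun = rectDist W Z₂.toFun := by
  have key : ∀ x₁ x₂ y₁ y₂ : I, ∫ x in Icc x₁ x₂, (cdfMeasure (Z₁.toFun x)).real (Icc y₁ y₂) =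
      ∫ x in Icc x₁ x₂, (cdfMeasure (Z₂.toFun x)).real (Icc y₁ y₂) := by
    intro x₁ x₂ y₁ y₂
    refine setIntegral_congr_ae measurableSet_Icc ?_
    filter_upwards [almostEqual_iff_ae.1 h] with x hx _
    rw [hx]
  simp only [rectDist, key]

end PermLimit

end

theorem theorem5p2 (Z₁ Z₂ : PermLimit.LimitPermutation) :
    (PermLimit.rectDist Z₁.toFun Z₂.toFun = 0 ↔ PermLimit.AlmostEqual Z₁ Z₂) ∧
    (∀ (π : ℕ → PermLimit.FinPerm) (Z : PermLimit.LimitPermutation),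
      PermLimit.ConvergesTo π Z ↔
        Tendsto (fun n => PermLimit.rectDist (PermLimit.stepFunction (π n)) Z.toFun)
          atTop (𝓝 0)) ∧
    (∀ π : ℕ → PermLimit.FinPerm, PermLimit.ConvergesTo π Z₁ →
      (PermLimit.ConvergesTo π Z₂ ↔ PermLimit.AlmostEqual Z₁ Z₂)) := by
  refine ⟨PermLimit.rectDist_eq_zero_iff Z₁ Z₂, PermLimit.convergesTo_iff_tendsto_rectDist,
    fun π h₁ => ⟨fun h₂ => h₁.almostEqual h₂, fun h => ?_⟩⟩
  rw [PermLimit.convergesTo_iff_tendsto_rectDist] at h₁ ⊢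
  simpa only [PermLimit.rectDist_congr_right h] using h₁
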